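/- Let $X_1,X_2,\dots$ be i.i.d. real random variables with $E|X_1|<\infty$ and $EX_1=0$. Put $S_n=X_1+\cdots+X_n$, $S_n^{(2)}=S_1+\cdots+S_n$ and $$p_n^{(2)}=P\Big(\max_{1\le k\le n}S_k^{(2)}<0\Big).$$ For sequences $f,g$ write $f(n)\asymp g(n)$ if there are constants $c,C\in(0,\infty)$, not depending on $n$, with $c\,g(n)\le f(n)\le C\,g(n)$ for all $n\ge1$. We say that $X_1$ satisfies the decay assumption if there exist constants $r>0$, $\theta>1/r$ and finite $K,L$ such that for all $t,s>0$ $$P(-X_1>t+s)\le K\,P(-X_1>t)\,P(-X_1>s)+L\,[P(-X_1>r)]^{\theta(t+s)}.$$ (a) If $X_1$ has a finite second moment and is not almost surely zero, then $E|S_n|\asymp\sqrt n$; if in addition $X_1$ satisfies the decay assumption, then $p_n^{(2)}\asymp n^{-1/4}$. (b) Let $1<\alpha<2$ and let $Y_1,Y_2,\dots$ be i.i.d. with the Pareto tail $P(Y_1>y)=y^{-\alpha}$ for all $y\ge1$. Then $Y_1$ is integrable, and for the i.i.d. variables $X_i=Y_i-EY_1$ the variable $X_1$ is integrable, has mean zero,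 is almost surely bounded below and satisfies the decay assumption; moreover $E|S_n|\asymp n^{1/\alpha}$ and $p_n^{(2)}\asymp n^{-\gamma}$ with $\gamma=(1-1/\alpha)/2$. (c) Consequently, for every $0<\gamma<1/4$ there is an i.i.d. sequence of integrable, zero-mean random variables for which $p_n^{(2)}\asymp n^{-\gamma}$, namely the sequence $X_i=Y_i-EY_1$ of (b) with the $\alpha\in(1,2)$ determined by $\gamma=(1-1/\alpha)/2$. -/

import Mathlib

open MeasureTheory ProbabilityTheory

/-- `X 0, X 1, X 2, …` (the variables usually written `X₁, X₂, X₃, …`) are independent and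
identically distributed real random variables on `(Ω, P)`. -/
structure IsIID {Ω : Type*} [MeasurableSpace Ω] (P : Measure Ω) (X : ℕ → Ω → ℝ) : Prop where
  indep : iIndepFun X P
  ident : ∀ i, IdentDistrib (X i) (X 0) P P

/-- The partial sum `S_n = X₁ + ⋯ + X_n` (with `X_k` stored at index `k - 1`). -/
def partialSum {Ω : Type*} (X : ℕ → Ω → ℝ) (n : ℕ) (ω : Ω) : ℝ :=
  ∑ i ∈ Finset.range n, X i ω

/-- The iterated partial sum `S_n^{(2)} = S₁ + ⋯ + S_n`. -/
def iteratedSum {Ω : Type*} (X : ℕ → Ω → ℝ) (n : ℕ) (ω : Ω) : ℝ :=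
  ∑ k ∈ Finset.Icc 1 n, partialSum X k ω

/-- The persistence probability `p_n^{(2)} = P(max_{1 ≤ k ≤ n} S_k^{(2)} < 0)`. -/
noncomputable def persistenceProb {Ω : Type*} [MeasurableSpace Ω] (P : Measure Ω)
    (X : ℕ → Ω → ℝ) (n : ℕ) : ℝ :=
  P.real {ω | ∀ k ∈ Finset.Icc 1 n, iteratedSum X k ω < 0}

/-- The decay assumption on the lower tail of a random variable `Z`: there are `r > 0`,
`θ > 1 / r` and finite `K`, `L` such that, for all `t, s > 0`,
`P(-Z > t + s) ≤ K P(-Z > t) P(-Z > s) + L P(-Z > r) ^ (θ (t + s))`. -/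
def DecayAssumption {Ω : Type*} [MeasurableSpace Ω] (P : Measure Ω) (Z : Ω → ℝ) : Prop :=
  ∃ r θ K L : ℝ, 0 < r ∧ 1 / r < θ ∧ ∀ t s : ℝ, 0 < t → 0 < s →
    P.real {ω | -Z ω > t + s} ≤
      K * P.real {ω | -Z ω > t} * P.real {ω | -Z ω > s} +
        L * P.real {ω | -Z ω > r} ^ (θ * (t + s))

/-- `f n ≍ g n`: each is bounded by a constant multiple of the other, for all `n ≥ 1`. -/
def SameOrder (f g : ℕ → ℝ) : Prop :=
  ∃ c C : ℝ, 0 < c ∧ 0 < C ∧ ∀ n : ℕ, 1 ≤ n → c * g n ≤ f n ∧ f n ≤ C * g n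

/-- The Pareto tail `P(Y > y) = y ^ (-α)` for `y ≥ 1` (so that `Y > 1` almost surely). -/
def HasParetoTail {Ω : Type*} [MeasurableSpace Ω] (P : Measure Ω) (Y : Ω → ℝ) (α : ℝ) : Prop :=
  ∀ y : ℝ, 1 ≤ y → P.real {ω | Y ω > y} = y ^ (-α)

/-- The centred sequence `X_i = Y_i - E Y₁`. -/
noncomputable def centred {Ω : Type*} [MeasurableSpace Ω] (P : Measure Ω) (Y : ℕ → Ω → ℝ)
    (i : ℕ) (ω : Ω) : ℝ :=
  Y i ω - ∫ ω', Y 0 ω' ∂P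

/-! ### Deterministic sequences -/

/-! Tilt the iterated walk by a slope `y` and ask where `j ↦ area x j + j * y` attains its maximum
on `{0, …, n + 2}`. For each interior index `i + 1` the maximizing slopes form an interval, whose
signed length is `slopeGap n x i`: the negated step `x (i + 1)`, minus an `ascent` of the reversed
past, minus an `ascent` of the future. Strict maximizers are unique, so the intervals are
essentially disjoint, and each lies between minus two consecutive values of the walk; hence the
positive parts add up to at most the range of the walk (`sum_slopeGap_le`). Conversely every slope
strictly between `-walk x 1` and `-walk x (n + 2)` has an interior maximizer (`le_sum_slopeGap`).

For i.i.d. steps the past, the step and the future are independent, and reversal does not change the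
law of the past. The expected positive length at `i + 1` is therefore at least a constant times `p i
* p (n - i)`, with `p` the persistence probability (`IsIID.mul_le_integral_slopeGap`); the decay
assumption gives the reverse bound (`IsIID.exists_integral_slopeGap_le`). So the convolution square
of `p` is bounded above by the expected maximum of the walk's absolute value and below by its first
absolute moment, up to constants. Truncation at level `n ^ (1 / α)` shows that both are of order `n
^ (1 / α)` (`IsIID.exists_maximal_bound_rpow`, `IsIID.sameOrder_integral_abs`); finite variance is
the case `α = 2`.

Since `p` decreases, the upper bound on the convolution gives `p n = O(n ^ (-γ))` with `1 - 2 * γ =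
1 / α`, and `exists_le_of_convolution` turns the lower bound into one for `p n` itself. -/

/-- The partial sums of a real sequence. -/
def walk (x : ℕ → ℝ) (n : ℕ) : ℝ := ∑ i ∈ Finset.range n, x i

/-- The iterated partial sums of a real sequence. -/
def area (x : ℕ → ℝ) (n : ℕ) : ℝ := ∑ k ∈ Finset.Icc 1 n, walk x k

/-- The least slope `u` for which `area x j ≤ (j + 1) * u` for all `j ≤ m`. -/
noncomputable def ascent (m : ℕ) (x : ℕ → ℝ) : ℝ :=
  (Finset.range (m + 1)).sup' Finset.nonempty_range_add_one fun j => area x j / (j + 1)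

/-- Reversal of the first `i + 1` terms of a sequence. -/
def revSeq (i : ℕ) (x : ℕ → ℝ) (l : ℕ) : ℝ := x (if l ≤ i then i - l else l)

/-- The sequence from index `i` on. -/
def shiftSeq (i : ℕ) (x : ℕ → ℝ) (l : ℕ) : ℝ := x (i + l)

/-- The signed length of the set of slopes `y` for which `j ↦ area x j + j * y` on `{0, …, n + 2}`
is maximal at `i + 1`. -/
noncomputable def slopeGap (n : ℕ) (x : ℕ → ℝ) (i : ℕ) : ℝ :=
  -x (i + 1) - ascent i (revSeq i x) - ascent (n - i) (shiftSeq (i + 2) x)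

@[simp] lemma walk_zero (x : ℕ → ℝ) : walk x 0 = 0 := by simp [walk]

lemma walk_succ (x : ℕ → ℝ) (n : ℕ) : walk x (n + 1) = walk x n + x n :=
  Finset.sum_range_succ _ _

@[simp] lemma area_zero (x : ℕ → ℝ) : area x 0 = 0 := by simp [area]

lemma area_succ (x : ℕ → ℝ) (n : ℕ) : area x (n + 1) = area x n + walk x (n + 1) :=
  Finset.sum_Icc_succ_top (by omega) _

lemma ascent_lt_iff {m : ℕ} {x : ℕ → ℝ} {u : ℝ} :
    ascent m x < u ↔ ∀ j ≤ m, area x j < (j + 1) * u := by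
  rw [ascent, Finset.sup'_lt_iff]
  simp only [Finset.mem_range, Nat.lt_succ_iff]
  refine forall₂_congr fun j _ => ?_
  rw [div_lt_iff₀ (by positivity), mul_comm]

lemma ascent_le_iff {m : ℕ} {x : ℕ → ℝ} {u : ℝ} :
    ascent m x ≤ u ↔ ∀ j ≤ m, area x j ≤ (j + 1) * u := by
  rw [ascent, Finset.sup'_le_iff]
  simp only [Finset.mem_range, Nat.lt_succ_iff]
  refine forall₂_congr fun j _ => ?_
  rw [div_le_iff₀ (by positivity), mul_comm]

lemma ascent_nonneg (m : ℕ) (x : ℕ → ℝ) : 0 ≤ ascent m x := by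
  by_contra! h
  simpa using ascent_lt_iff.1 h 0 (Nat.zero_le _)

lemma walk_shiftSeq (x : ℕ → ℝ) (k j : ℕ) :
    walk x (k + j) = walk x k + walk (shiftSeq k x) j := by
  induction j with
  | zero => simp
  | succ j ih => rw [← add_assoc, walk_succ, walk_succ, ih, shiftSeq]; ring

lemma area_shiftSeq (x : ℕ → ℝ) (k j : ℕ) :
    area x (k + j) = area x k + j * walk x k + area (shiftSeq k x) j := by
  induction j with
  | zero => simp
  | succ j ih => rw [← add_assoc, area_succ, area_succ, ih, add_assoc k, walk_shiftSeq]; push_cast; ring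

lemma walk_revSeq (x : ℕ → ℝ) {i j a : ℕ} (h : a + j = i + 1) :
    walk x (i + 1) = walk x a + walk (revSeq i x) j := by
  induction j generalizing a with
  | zero => simp [← h]
  | succ j ih =>
    rw [ih (a := a + 1) (by omega), walk_succ, walk_succ, revSeq, if_pos (by omega),
      show i - j = a by omega]
    ring

/-- Seen backwards from `i + 1`, the walk at `i + 1 - l` is `walk x (i + 1)` minus the reversed walk
at `l`; summing over `l = 0, …, j` gives the identity. -/
lemma area_revSeq (x : ℕ → ℝ) {i j a : ℕ} (h : a + j = i) :
    area x (i + 1) = area x a + (j + 1) * walk x (i + 1) - area (revSeq i x) j := by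
  induction j generalizing a with
  | zero => obtain rfl : a = i := by omega
            simp [area_succ]
  | succ j ih =>
    rw [ih (a := a + 1) (by omega), area_succ, area_succ,
      walk_revSeq x (i := i) (j := j + 1) (a := a + 1) (by omega)]
    push_cast; ring

/-- The past half of maximality at `i + 1`; `ascent_shiftSeq_lt_iff` is the future half. The strict
forms give disjoint slope intervals, the weak forms a covering. -/
lemma ascent_revSeq_lt_iff {x : ℕ → ℝ} {i : ℕ} {y : ℝ} :
    ascent i (revSeq i x) < walk x (i + 1) + y ↔
      ∀ a ≤ i, area x a + a * y < area x (i + 1) + (i + 1 : ℕ) * y := by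
  rw [ascent_lt_iff]
  constructor
  · intro h a ha
    have := h (i - a) (by omega)
    rw [area_revSeq x (show a + (i - a) = i by omega)]
    push_cast [Nat.cast_sub ha] at this ⊢
    linarith
  · intro h j hj
    have := h (i - j) (by omega)
    rw [area_revSeq x (show (i - j) + j = i by omega)] at this
    push_cast [Nat.cast_sub hj] at this ⊢
    linarith

lemma ascent_revSeq_le_iff {x : ℕ → ℝ} {i : ℕ} {y : ℝ} :
    ascent i (revSeq i x) ≤ walk x (i + 1) + y ↔
      ∀ a ≤ i, area x a + a * y ≤ area x (i + 1) + (i + 1 : ℕ) * y := by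
  rw [ascent_le_iff]
  constructor
  · intro h a ha
    have := h (i - a) (by omega)
    rw [area_revSeq x (show a + (i - a) = i by omega)]
    push_cast [Nat.cast_sub ha] at this ⊢
    linarith
  · intro h j hj
    have := h (i - j) (by omega)
    rw [area_revSeq x (show (i - j) + j = i by omega)] at this
    push_cast [Nat.cast_sub hj] at this ⊢
    linarith

lemma ascent_shiftSeq_lt_iff {x : ℕ → ℝ} {k m : ℕ} {y : ℝ} :
    ascent m (shiftSeq (k + 1) x) < -(walk x (k + 1) + y) ↔
      ∀ j ≤ m, area x (k + 1 + j) + (k + 1 + j : ℕ) * y < area x k + k * y := by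
  rw [ascent_lt_iff]
  refine forall₂_congr fun j _ => ?_
  rw [area_shiftSeq, area_succ]
  push_cast
  constructor <;> intro h <;> linarith

lemma ascent_shiftSeq_le_iff {x : ℕ → ℝ} {k m : ℕ} {y : ℝ} :
    ascent m (shiftSeq (k + 1) x) ≤ -(walk x (k + 1) + y) ↔
      ∀ j ≤ m, area x (k + 1 + j) + (k + 1 + j : ℕ) * y ≤ area x k + k * y := by
  rw [ascent_le_iff]
  refine forall₂_congr fun j _ => ?_
  rw [area_shiftSeq, area_succ]
  push_cast
  constructor <;> intro h <;> linarith

/-- The slopes `y` for which the maximum of `j ↦ area x j + j * y` is at an interior point lie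
between minus the largest and minus the smallest value of the walk. -/
lemma sum_slopeGap_le {n : ℕ} {x : ℕ → ℝ} {M : ℝ} (hM : ∀ j ≤ n + 2, |walk x j| ≤ M) :
    ∑ i ∈ Finset.range (n + 1), max (slopeGap n x i) 0 ≤ 2 * M := by
  have hM0 : 0 ≤ M := (abs_nonneg _).trans (hM 0 (by omega))
  set I : ℕ → Set ℝ := fun i => Set.Ioo (-walk x (i + 1) + ascent i (revSeq i x))
    (-walk x (i + 2) - ascent (n - i) (shiftSeq (i + 2) x)) with hI
  have hvol : ∀ i, volume (I i) = ENNReal.ofReal (max (slopeGap n x i) 0) := by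
    intro i
    rw [hI, Real.volume_Ioo, ENNReal.ofReal_max, ENNReal.ofReal_zero, max_eq_left (by simp)]
    congr 1
    rw [slopeGap, walk_succ x (i + 1)]; ring
  have key : ∀ i ∈ Finset.range (n + 1), ∀ y ∈ I i, ∀ a ≤ n + 2, a ≠ i + 1 →
      area x a + a * y < area x (i + 1) + (i + 1 : ℕ) * y := by
    intro i hi y hy a ha hne
    rw [Finset.mem_range] at hi
    rcases Nat.lt_or_ge a (i + 1) with h | h
    · exact ascent_revSeq_lt_iff.1 (by linarith [hy.1]) a (by omega)
    · obtain ⟨j, rfl⟩ := Nat.exists_eq_add_of_le (show i + 1 + 1 ≤ a by omega)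
      refine ascent_shiftSeq_lt_iff (k := i + 1) (m := n - i) (y := y) |>.1 ?_ j (by omega)
      linarith [hy.2]
  -- A slope in two of the intervals would have two distinct strict maximizers.
  have hdisj : Set.PairwiseDisjoint (↑(Finset.range (n + 1))) I := by
    intro i hi j hj hij
    refine Set.disjoint_left.2 fun y hyi hyj => ?_
    have hi' := Finset.mem_range.1 (Finset.mem_coe.1 hi)
    have hj' := Finset.mem_range.1 (Finset.mem_coe.1 hj)
    exact lt_asymm (key i hi y hyi (j + 1) (by omega) (by omega))
      (key j hj y hyj (i + 1) (by omega) (by omega))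
  have hsub : (⋃ i ∈ Finset.range (n + 1), I i) ⊆ Set.Icc (-M) M := by
    intro y hy
    simp only [Set.mem_iUnion] at hy
    obtain ⟨i, hi, hy⟩ := hy
    rw [Finset.mem_range] at hi
    have h1 := ascent_nonneg i (revSeq i x)
    have h2 := ascent_nonneg (n - i) (shiftSeq (i + 2) x)
    have h3 := (abs_le.1 (hM (i + 1) (by omega))).2
    have h4 := (abs_le.1 (hM (i + 2) (by omega))).1
    exact ⟨by linarith [hy.1], by linarith [hy.2]⟩
  have h := measure_mono (μ := volume) hsub
  rw [measure_biUnion_finset hdisj (fun i _ => measurableSet_Ioo), Real.volume_Icc,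
    Finset.sum_congr rfl (fun i _ => hvol i), ← ENNReal.ofReal_sum_of_nonneg
      (fun i _ => le_max_right _ _)] at h
  rw [ENNReal.ofReal_le_ofReal_iff (by linarith)] at h
  linarith

/-- For `y` strictly between `-walk x 1` and `-walk x (n + 2)` the tilted sequence rises in its
first step and falls in its last, so its maximum is interior and the closed intervals cover all such
`y`. -/
lemma le_sum_slopeGap (n : ℕ) (x : ℕ → ℝ) :
    max (walk x 1 - walk x (n + 2)) 0 ≤ ∑ i ∈ Finset.range (n + 1), max (slopeGap n x i) 0 := by
  set I : ℕ → Set ℝ := fun i => Set.Icc (-walk x (i + 1) + ascent i (revSeq i x))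
    (-walk x (i + 2) - ascent (n - i) (shiftSeq (i + 2) x)) with hI
  have hvol : ∀ i, volume (I i) = ENNReal.ofReal (max (slopeGap n x i) 0) := by
    intro i
    rw [hI, Real.volume_Icc, ENNReal.ofReal_max, ENNReal.ofReal_zero, max_eq_left (by simp)]
    congr 1
    rw [slopeGap, walk_succ x (i + 1)]; ring
  have hsub : Set.Ioo (-walk x 1) (-walk x (n + 2)) ⊆ ⋃ i ∈ Finset.range (n + 1), I i := by
    intro y hy
    obtain ⟨k, hk, hmax⟩ := Finset.exists_max_image (Finset.range (n + 3))
      (fun j : ℕ => area x j + j * y) ⟨0, by simp⟩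
    simp only [Finset.mem_range] at hk hmax
    have h0 : k ≠ 0 := by
      rintro rfl
      have := hmax 1 (by omega)
      rw [area_succ] at this
      simp only [area_zero, Nat.cast_one, Nat.cast_zero, zero_add] at this
      linarith [hy.1]
    have hN : k ≠ n + 2 := by
      rintro rfl
      have := hmax (n + 1) (by omega)
      rw [area_succ x (n + 1)] at this
      push_cast at this
      linarith [hy.2]
    obtain ⟨i, rfl⟩ := Nat.exists_eq_succ_of_ne_zero h0
    simp only [Set.mem_iUnion, Finset.mem_range]
    refine ⟨i, by omega, ?_, ?_⟩
    · have := ascent_revSeq_le_iff.2 (fun a ha => hmax a (by omega))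
      linarith
    · have := ascent_shiftSeq_le_iff (k := i + 1) (m := n - i) (y := y).2
        (fun j hj => hmax _ (by omega))
      linarith
  have h := (measure_mono (μ := volume) hsub).trans (measure_biUnion_finset_le _ _)
  rw [Real.volume_Ioo, Finset.sum_congr rfl (fun i _ => hvol i), ← ENNReal.ofReal_sum_of_nonneg
      (fun i _ => le_max_right _ _), ENNReal.ofReal_le_ofReal_iff
      (Finset.sum_nonneg fun i _ => le_max_right _ _)] at h
  exact max_le (by linarith) (Finset.sum_nonneg fun i _ => le_max_right _ _)

/-! ### Running maxima of deterministic walks. -/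

/-- The running maximum of a walk. -/
noncomputable def runMax (x : ℕ → ℝ) : ℕ → ℝ
  | 0 => 0
  | n + 1 => max (runMax x n) (walk x (n + 1))

lemma runMax_nonneg (x : ℕ → ℝ) (n : ℕ) : 0 ≤ runMax x n := by
  induction n with
  | zero => exact le_rfl
  | succ n ih => exact ih.trans (le_max_left _ _)

lemma walk_le_runMax (x : ℕ → ℝ) {j n : ℕ} (h : j ≤ n) : walk x j ≤ runMax x n := by
  induction n with
  | zero => obtain rfl : j = 0 := by omega
            simp [runMax]
  | succ n ih =>
    rcases Nat.lt_or_ge j (n + 1) with h' | h'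
    · exact (ih (by omega)).trans (le_max_left _ _)
    · obtain rfl : j = n + 1 := by omega
      exact le_max_right _ _

/-- A pathwise form of Doob's `L²` maximal inequality. -/
lemma sq_runMax_add_le (x : ℕ → ℝ) (n : ℕ) :
    runMax x n ^ 2 / 2 + ∑ k ∈ Finset.range n, runMax x k * x k ≤ runMax x n * walk x n := by
  induction n with
  | zero => simp [runMax]
  | succ n ih =>
    rw [Finset.sum_range_succ, runMax]
    have hs := walk_succ x n
    rcases le_total (walk x (n + 1)) (runMax x n) with h | h
    · rw [max_eq_left h, hs]; linarith
    · rw [max_eq_right h]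
      have : x n = walk x (n + 1) - walk x n := by linarith
      rw [this]
      -- At a new maximum the inequality gains half the square of the jump of the running maximum.
      nlinarith [sq_nonneg (walk x (n + 1) - runMax x n)]

/-! ### Convolution squares of decreasing sequences -/

/-- Bernoulli's inequality for the exponent `1 - γ` at `-1 / (n + 1)`; it makes sums of `n ^ (-γ)`
telescope. -/
lemma rpow_sub_rpow_ge {γ : ℝ} (h0 : 0 ≤ γ) (h1 : γ ≤ 1) (n : ℕ) :
    (1 - γ) * ((n : ℝ) + 1) ^ (-γ) ≤ ((n : ℝ) + 1) ^ (1 - γ) - (n : ℝ) ^ (1 - γ) := by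
  have hn : (0 : ℝ) < (n : ℝ) + 1 := by positivity
  have h := rpow_one_add_le_one_add_mul_self (s := -1 / ((n : ℝ) + 1)) (p := 1 - γ)
    (by rw [le_div_iff₀ hn]; linarith [(Nat.cast_nonneg n : (0 : ℝ) ≤ n)])
    (by linarith) (by linarith)
  have e : 1 + -1 / ((n : ℝ) + 1) = n / (n + 1) := by field_simp; ring
  rw [e, Real.div_rpow (Nat.cast_nonneg n) hn.le, div_le_iff₀ (by positivity)] at h
  have e2 : ((n : ℝ) + 1) ^ (1 - γ) = ((n : ℝ) + 1) * ((n : ℝ) + 1) ^ (-γ) := by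
    rw [sub_eq_add_neg, Real.rpow_add hn, Real.rpow_one]
  have e3 : (1 + (1 - γ) * (-1 / ((n : ℝ) + 1))) * ((n : ℝ) + 1) ^ (1 - γ) =
      ((n : ℝ) + 1) ^ (1 - γ) - (1 - γ) * ((n : ℝ) + 1) ^ (-γ) := by
    rw [e2]; field_simp; ring
  linarith

lemma sum_range_le_rpow {p : ℕ → ℝ} {γ C : ℝ} (h0 : 0 ≤ γ) (h1 : γ < 1) (hC0 : 0 ≤ C)
    (hp0 : p 0 ≤ 1) (hC : ∀ n : ℕ, 1 ≤ n → p n ≤ C * (n : ℝ) ^ (-γ)) {n : ℕ} (hn : 1 ≤ n) :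
    ∑ i ∈ Finset.range n, p i ≤ (1 + 2 * C / (1 - γ)) * (n : ℝ) ^ (1 - γ) := by
  have hpos : 0 < 1 - γ := by linarith
  induction n, hn using Nat.le_induction with
  | base =>
    simp only [Finset.range_one, Finset.sum_singleton, Nat.cast_one, Real.one_rpow, mul_one]
    have : 0 ≤ 2 * C / (1 - γ) := by positivity
    linarith
  | succ n hn ih =>
    rw [Finset.sum_range_succ]
    have hn' : (1 : ℝ) ≤ n := by exact_mod_cast hn
    have h2 := rpow_sub_rpow_ge h0 h1.le n
    have h3 : (n : ℝ) ^ (-γ) ≤ 2 * ((n : ℝ) + 1) ^ (-γ) := by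
      have h4 : (2 * (n : ℝ)) ^ (-γ) ≤ ((n : ℝ) + 1) ^ (-γ) :=
        Real.rpow_le_rpow_of_nonpos (by positivity) (by linarith) (by linarith)
      have h5 : (2 : ℝ)⁻¹ ≤ (2 : ℝ) ^ (-γ) := by
        rw [← Real.rpow_neg_one]
        exact Real.rpow_le_rpow_of_exponent_le (by norm_num) (by linarith)
      rw [Real.mul_rpow (by norm_num) (by positivity)] at h4
      have h6 : 0 ≤ (n : ℝ) ^ (-γ) := by positivity
      nlinarith
    have h7 : C * (n : ℝ) ^ (-γ) ≤
        2 * C / (1 - γ) * (((n : ℝ) + 1) ^ (1 - γ) - (n : ℝ) ^ (1 - γ)) := by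
      calc C * (n : ℝ) ^ (-γ) ≤ C * (2 * ((n : ℝ) + 1) ^ (-γ)) := by gcongr
        _ = 2 * C / (1 - γ) * ((1 - γ) * ((n : ℝ) + 1) ^ (-γ)) := by field_simp
        _ ≤ _ := by gcongr
    have h8 : (n : ℝ) ^ (1 - γ) ≤ ((n : ℝ) + 1) ^ (1 - γ) := by gcongr; linarith
    push_cast
    linarith [hC n hn]

/-- A decreasing sequence that is `O(n ^ (-γ))`, and whose convolution square is at least of order
`n ^ (1 - 2 * γ)`, is at least of order `n ^ (-γ)`. -/
lemma exists_le_of_convolution {p : ℕ → ℝ} {γ C c : ℝ} (h0 : 0 < γ) (h1 : γ < 1 / 2)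
    (hanti : Antitone p) (hp : ∀ n, 0 ≤ p n) (hp0 : p 0 ≤ 1)
    (hC : ∀ n : ℕ, 1 ≤ n → p n ≤ C * (n : ℝ) ^ (-γ)) (hc : 0 < c)
    (hconv : ∀ n : ℕ, 1 ≤ n → c * (n : ℝ) ^ (1 - 2 * γ) ≤
      ∑ i ∈ Finset.range (n + 1), p i * p (n - i)) :
    ∃ c' : ℝ, 0 < c' ∧ ∀ n : ℕ, 1 ≤ n → c' * (n : ℝ) ^ (-γ) ≤ p n := by
  wlog hC1 : 1 ≤ C generalizing C
  · refine this (C := max C 1) (fun n hn => (hC n hn).trans ?_) (le_max_right _ _)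
    gcongr; exact le_max_left _ _
  set D : ℝ := C * (1 + 2 * C / (1 - γ)) with hD
  have hDpos : 0 < D := by
    have : 0 ≤ 2 * C / (1 - γ) := div_nonneg (by linarith) (by linarith)
    exact mul_pos (by linarith) (by linarith)
  -- The convolution is examined at `M * n`. Its two end blocks contribute at most `2 * D * n ^ (1 -
  -- 2 * γ)`; this `M` makes that at most half of the assumed lower bound.
  obtain ⟨M, hM2, hM⟩ : ∃ M : ℕ, 2 ≤ M ∧ 4 * D ≤ c * (M : ℝ) ^ (1 - 2 * γ) := by
    have ht : Filter.Tendsto (fun M : ℕ => c * (M : ℝ) ^ (1 - 2 * γ)) Filter.atTop Filter.atTop :=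
      ((tendsto_rpow_atTop (by linarith)).comp tendsto_natCast_atTop_atTop).const_mul_atTop hc
    obtain ⟨M, h⟩ := ((Filter.eventually_ge_atTop 2).and (ht.eventually_ge_atTop (4 * D))).exists
    exact ⟨M, h.1, h.2⟩
  have hM0 : (0 : ℝ) < M := by exact_mod_cast (by omega : 0 < M)
  refine ⟨Real.sqrt (D / M), Real.sqrt_pos.2 (by positivity), fun n hn => ?_⟩
  have hn' : (1 : ℝ) ≤ n := by exact_mod_cast hn
  -- At most one of the two indices is below `n`; monotonicity replaces every factor with index at
  -- least `n` by `p n`.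
  have hterm : ∀ i ∈ Finset.range (M * n + 1), p i * p (M * n - i) ≤
      (if i < n then p i * p n else 0) + (if M * n - i < n then p (M * n - i) * p n else 0) +
        p n ^ 2 := by
    intro i hi
    have hi' := Finset.mem_range.1 hi
    have hMn : 2 * n ≤ M * n := Nat.mul_le_mul_right n hM2
    by_cases a : i < n
    · have b : ¬ (M * n - i < n) := by omega
      rw [if_pos a, if_neg b]
      have := mul_le_mul_of_nonneg_left (hanti (show n ≤ M * n - i by omega)) (hp i)
      nlinarith [sq_nonneg (p n)]
    · rw [if_neg a]
      by_cases b : M * n - i < n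
      · rw [if_pos b]
        have := mul_le_mul_of_nonneg_left (hanti (show n ≤ i by omega)) (hp (M * n - i))
        nlinarith [sq_nonneg (p n)]
      · rw [if_neg b]
        have := mul_le_mul (hanti (show n ≤ i by omega)) (hanti (show n ≤ M * n - i by omega))
          (hp _) (hp _)
        nlinarith
  have hs : ∑ i ∈ Finset.range (M * n + 1), (if i < n then p i * p n else 0) =
      (∑ i ∈ Finset.range n, p i) * p n := by
    rw [← Finset.sum_filter, Finset.sum_mul]
    congr 1
    ext i
    simp only [Finset.mem_filter, Finset.mem_range]
    have : 2 * n ≤ M * n := Nat.mul_le_mul_right n hM2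
    omega
  have hs' : ∑ i ∈ Finset.range (M * n + 1),
      (if M * n - i < n then p (M * n - i) * p n else 0) =
      (∑ i ∈ Finset.range n, p i) * p n := by
    rw [← hs, ← Finset.sum_range_reflect (fun i => if i < n then p i * p n else 0)]
    simp
  have hsum := (hconv (M * n) (by nlinarith)).trans (Finset.sum_le_sum hterm)
  rw [Finset.sum_add_distrib, Finset.sum_add_distrib, hs, hs'] at hsum
  simp only [Finset.sum_const, Finset.card_range, nsmul_eq_mul] at hsum
  push_cast at hsum
  rw [Real.mul_rpow hM0.le (by positivity)] at hsum
  have hbound : (∑ i ∈ Finset.range n, p i) * p n ≤ D * (n : ℝ) ^ (1 - 2 * γ) := by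
    have a := sum_range_le_rpow h0.le (by linarith) (by linarith) hp0 hC hn
    have b := mul_le_mul a (hC n hn) (hp n) ((Finset.sum_nonneg fun i _ => hp i).trans a)
    refine b.trans_eq ?_
    rw [show (1 : ℝ) - 2 * γ = (1 - γ) + (-γ) by ring, Real.rpow_add (by linarith), hD]
    ring
  have hpow : (n : ℝ) ^ (1 - 2 * γ) = n * ((n : ℝ) ^ (-γ)) ^ 2 := by
    rw [← Real.rpow_natCast, ← Real.rpow_mul (by linarith),
      show (1 : ℝ) - 2 * γ = 1 + (-γ) * (2 : ℕ) by push_cast; ring, Real.rpow_add (by linarith),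
      Real.rpow_one]
  have hM1 : (M : ℝ) * n + 1 ≤ 2 * M * n := by
    have : (2 : ℝ) ≤ M := by exact_mod_cast hM2
    nlinarith
  have hfin : D * ((n : ℝ) ^ (-γ)) ^ 2 ≤ M * p n ^ 2 := by
    have a : 4 * D * (n : ℝ) ^ (1 - 2 * γ) ≤ c * ((M : ℝ) ^ (1 - 2 * γ) * (n : ℝ) ^ (1 - 2 * γ)) := by
      rw [← mul_assoc c]
      exact mul_le_mul_of_nonneg_right hM (by positivity)
    have b : ((M : ℝ) * n + 1) * p n ^ 2 ≤ 2 * M * n * p n ^ 2 := by gcongr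
    rw [hpow] at hsum hbound a
    have : n * (D * ((n : ℝ) ^ (-γ)) ^ 2) ≤ n * (M * p n ^ 2) := by linarith
    exact le_of_mul_le_mul_left this (by linarith)
  refine le_of_sq_le_sq ?_ (hp n)
  rw [mul_pow, Real.sq_sqrt (by positivity), div_mul_eq_mul_div, div_le_iff₀ hM0]
  linarith

/-! ### Independent identically distributed sequences -/

lemma measurable_walk_of_lt {Ω : Type*} {mΩ : MeasurableSpace Ω} {Z : ℕ → Ω → ℝ} {m : ℕ}
    (h : ∀ l < m, Measurable (Z l)) : Measurable fun ω => walk (fun l => Z l ω) m :=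
  Finset.measurable_sum _ fun l hl => h l (Finset.mem_range.1 hl)

lemma measurable_area_of_lt {Ω : Type*} {mΩ : MeasurableSpace Ω} {Z : ℕ → Ω → ℝ} {m : ℕ}
    (h : ∀ l < m, Measurable (Z l)) : Measurable fun ω => area (fun l => Z l ω) m :=
  Finset.measurable_sum _ fun k hk => measurable_walk_of_lt fun l hl =>
    h l (hl.trans_le (Finset.mem_Icc.1 hk).2)

lemma measurable_ascent_of_lt {Ω : Type*} {mΩ : MeasurableSpace Ω} {Z : ℕ → Ω → ℝ} {m : ℕ}
    (h : ∀ l < m, Measurable (Z l)) : Measurable fun ω => ascent m (fun l => Z l ω) := by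
  refine measurable_of_Iio fun u => ?_
  have : (fun ω => ascent m (fun l => Z l ω)) ⁻¹' Set.Iio u =
      ⋂ j : Set.Iic m, {ω | area (fun l => Z l ω) j < (j + 1) * u} := by
    ext ω
    simp [ascent_lt_iff]
  rw [this]
  exact MeasurableSet.iInter fun j => measurableSet_lt
    (measurable_area_of_lt fun l hl => h l (hl.trans_le j.2)) measurable_const

lemma measurable_walk (m : ℕ) : Measurable fun x => walk x m :=
  measurable_walk_of_lt fun l _ => measurable_pi_apply l

lemma measurable_ascent (m : ℕ) : Measurable (ascent m) :=
  measurable_ascent_of_lt fun l _ => measurable_pi_apply l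

section

variable {Ω : Type*} [MeasurableSpace Ω] {P : Measure Ω} [IsProbabilityMeasure P]
  {X : ℕ → Ω → ℝ}

lemma IsIID.map_eq (hX : IsIID P X) (hm : ∀ i, Measurable (X i)) {σ : ℕ → ℕ}
    (hσ : σ.Injective) :
    P.map (fun ω i => X (σ i) ω) = Measure.infinitePi fun _ : ℕ => P.map (X 0) := by
  rw [(hX.indep.precomp hσ).map_fun_eq_infinitePi_map fun i => hm _]
  congr 1
  ext1 i
  exact (hX.ident _).map_eq

/-- A function of an i.i.d. sequence has the same law along every injective reindexing. -/
lemma IsIID.identDistrib (hX : IsIID P X) (hm : ∀ i, Measurable (X i)) {σ τ : ℕ → ℕ}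
    (hσ : σ.Injective) (hτ : τ.Injective) {β : Type*} [MeasurableSpace β]
    {g : (ℕ → ℝ) → β} (hg : Measurable g) :
    IdentDistrib (fun ω => g fun i => X (σ i) ω) (fun ω => g fun i => X (τ i) ω) P P := by
  have h1 : Measurable fun ω i => X (σ i) ω := measurable_pi_iff.2 fun i => hm _
  have h2 : Measurable fun ω i => X (τ i) ω := measurable_pi_iff.2 fun i => hm _
  exact IdentDistrib.comp (u := g) ⟨h1.aemeasurable, h2.aemeasurable,
    (hX.map_eq hm hσ).trans (hX.map_eq hm hτ).symm⟩ hg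

lemma IsIID.indepFun (hX : IsIID P X) (hm : ∀ i, Measurable (X i)) {S T : Set ℕ}
    (hST : Disjoint S T) {β γ : Type*} [MeasurableSpace β] [MeasurableSpace γ] {f : Ω → β}
    {g : Ω → γ}
    (hf : Measurable[⨆ l ∈ S, MeasurableSpace.comap (X l) inferInstance] f)
    (hg : Measurable[⨆ l ∈ T, MeasurableSpace.comap (X l) inferInstance] g) :
    IndepFun f g P := by
  have h := indep_iSup_of_disjoint (fun l => (hm l).comap_le) hX.indep hST
  rw [IndepFun_iff_Indep]
  exact indep_of_indep_of_le_left (indep_of_indep_of_le_right h hg.comap_le) hf.comap_le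

omit [MeasurableSpace Ω] in
lemma measurable_iSup_comap {S : Set ℕ} {l : ℕ} (hl : l ∈ S) :
    Measurable[⨆ l ∈ S, MeasurableSpace.comap (X l) inferInstance] (X l) :=
  (comap_measurable (X l)).mono (le_iSup₂_of_le l hl le_rfl) le_rfl

/-- Because `revSeq` fixes the indices beyond `i`, it is an injective reindexing of the whole
sequence and so preserves its law. -/
lemma revIndex_injective (i : ℕ) : Function.Injective fun l => if l ≤ i then i - l else l := by
  intro a b h
  simp only at h
  split_ifs at h <;> omega

lemma persistenceProb_eq (m : ℕ) :
    persistenceProb P X m = P.real {ω | ∀ k ∈ Finset.Icc 1 m, area (fun i => X i ω) k < 0} :=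
  rfl

lemma persistenceProb_antitone : Antitone (persistenceProb P X) := by
  intro m n h
  refine measureReal_mono fun ω hω k hk => hω k ?_
  rw [Finset.mem_Icc] at hk ⊢
  omega

lemma persistenceProb_nonneg (m : ℕ) : 0 ≤ persistenceProb P X m := measureReal_nonneg

lemma persistenceProb_le_one (m : ℕ) : persistenceProb P X m ≤ 1 := measureReal_le_one

/-- The first step enters the iterated sum at index `1 + j` exactly `j + 1` times; this is the
origin of the denominator in `ascent`. -/
lemma forall_area_lt_iff {x : ℕ → ℝ} {m : ℕ} :
    (∀ k ∈ Finset.Icc 1 (m + 1), area x k < 0) ↔ ascent m (shiftSeq 1 x) < -x 0 := by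
  have hw : walk x 1 = x 0 := by simp [walk]
  have ha : area x 1 = x 0 := by simp [area_succ, hw]
  rw [ascent_lt_iff]
  constructor
  · intro h j hj
    have := h (1 + j) (Finset.mem_Icc.2 (by omega))
    rw [area_shiftSeq, hw, ha] at this
    linarith
  · intro h k hk
    obtain ⟨j, rfl⟩ := Nat.exists_eq_add_of_le (Finset.mem_Icc.1 hk).1
    have := h j (by have := (Finset.mem_Icc.1 hk).2; omega)
    rw [area_shiftSeq, hw, ha]
    linarith

lemma persistenceProb_succ (m : ℕ) : persistenceProb P X (m + 1) =
    P.real {ω | ascent m (fun l => X (1 + l) ω) < -X 0 ω} := by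
  rw [persistenceProb_eq]
  congr 1
  ext ω
  exact forall_area_lt_iff (x := fun i => X i ω)

lemma persistenceProb_le_ascent (m : ℕ) :
    persistenceProb P X m ≤ P.real {ω | ascent m (fun l => X l ω) ≤ 0} := by
  refine measureReal_mono fun ω hω => ascent_le_iff.2 fun j hj => ?_
  rw [mul_zero]
  rcases Nat.eq_zero_or_pos j with rfl | h
  · simp
  · exact (hω j (Finset.mem_Icc.2 ⟨h, hj⟩)).le

/-! ### Independence and laws of the two ascents. -/

section Pieces

variable (hX : IsIID P X) (hm : ∀ i, Measurable (X i))
include hX hm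

/-- The two ascents in `slopeGap` are independent. -/
lemma IsIID.indepFun_ascent (i k : ℕ) :
    IndepFun (fun ω => ascent i (revSeq i fun l => X l ω))
      (fun ω => ascent k (shiftSeq (i + 2) fun l => X l ω)) P := by
  refine hX.indepFun hm (S := Set.Iic i) (T := Set.Ici (i + 2))
    (Set.disjoint_left.2 fun a ha hb => by simp only [Set.mem_Iic, Set.mem_Ici] at ha hb; omega)
    ?_ ?_
  · refine measurable_ascent_of_lt fun l hl => measurable_iSup_comap ?_
    rw [if_pos hl.le]; exact Nat.sub_le _ _
  · exact measurable_ascent_of_lt fun l hl => measurable_iSup_comap (Nat.le_add_right _ _)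

lemma IsIID.indepFun_pair_ascent (i k : ℕ) :
    IndepFun (fun ω => (ascent i (revSeq i fun l => X l ω),
      ascent k (shiftSeq (i + 2) fun l => X l ω))) (X (i + 1)) P := by
  refine hX.indepFun hm (S := {i + 1}ᶜ) (T := {i + 1}) disjoint_compl_left ?_
    (measurable_iSup_comap rfl)
  refine Measurable.prodMk ?_ ?_
  · refine measurable_ascent_of_lt fun l hl => measurable_iSup_comap ?_
    rw [if_pos hl.le, Set.mem_compl_singleton_iff]; omega
  · refine measurable_ascent_of_lt fun l hl => measurable_iSup_comap ?_
    rw [Set.mem_compl_singleton_iff]; omega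

lemma IsIID.indepFun_ascent_shift (m : ℕ) :
    IndepFun (fun ω => ascent m fun l => X (1 + l) ω) (X 0) P := by
  refine hX.indepFun hm (S := {0}ᶜ) (T := {0}) disjoint_compl_left ?_
    (measurable_iSup_comap rfl)
  refine measurable_ascent_of_lt fun l hl => measurable_iSup_comap ?_
  rw [Set.mem_compl_singleton_iff]; omega

lemma IsIID.identDistrib_ascent_rev (i : ℕ) :
    IdentDistrib (fun ω => ascent i (revSeq i fun l => X l ω))
      (fun ω => ascent i fun l => X l ω) P P :=
  hX.identDistrib hm (revIndex_injective i) Function.injective_id (measurable_ascent i)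

lemma IsIID.identDistrib_ascent_shift (i k : ℕ) :
    IdentDistrib (fun ω => ascent k (shiftSeq i fun l => X l ω))
      (fun ω => ascent k fun l => X l ω) P P :=
  hX.identDistrib hm (add_right_injective i) Function.injective_id (measurable_ascent k)

lemma IsIID.measurable_ascent_rev (i : ℕ) :
    Measurable (fun ω => ascent i (revSeq i fun l => X l ω)) :=
  measurable_ascent_of_lt fun l _ => hm _

lemma IsIID.measurable_ascent_shift (i k : ℕ) :
    Measurable (fun ω => ascent k (shiftSeq i fun l => X l ω)) :=
  measurable_ascent_of_lt fun l _ => hm _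

end Pieces

end

/-! ### Expected slope gaps and the convolution square. -/

section

variable {Ω : Type*} [MeasurableSpace Ω] {P : Measure Ω} [IsProbabilityMeasure P]
  {X : ℕ → Ω → ℝ}

lemma IsIID.integrable (hX : IsIID P X) (hi : Integrable (X 0) P) (i : ℕ) : Integrable (X i) P :=
  (hX.ident i).integrable_iff.2 hi

lemma IsIID.measurable_slopeGap (hX : IsIID P X) (hm : ∀ i, Measurable (X i)) (n i : ℕ) :
    Measurable fun ω => slopeGap n (fun l => X l ω) i :=
  ((hm _).neg.sub (hX.measurable_ascent_rev hm i)).sub (hX.measurable_ascent_shift hm (i + 2) _)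

lemma IsIID.integrable_slopeGap (hX : IsIID P X) (hm : ∀ i, Measurable (X i))
    (hi : Integrable (X 0) P) (n i : ℕ) :
    Integrable (fun ω => max (slopeGap n (fun l => X l ω) i) 0) P := by
  refine (hX.integrable hi (i + 1)).mono
    ((hX.measurable_slopeGap hm n i).max measurable_const).aestronglyMeasurable
    (Filter.Eventually.of_forall fun ω => ?_)
  rw [Real.norm_eq_abs, Real.norm_eq_abs, abs_of_nonneg (le_max_right _ _)]
  refine max_le ?_ (abs_nonneg _)
  have h1 := ascent_nonneg i (revSeq i fun l => X l ω)
  have h2 := ascent_nonneg (n - i) (shiftSeq (i + 2) fun l => X l ω)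
  have h3 := neg_le_abs (X (i + 1) ω)
  rw [slopeGap]
  linarith

/-- When both ascents are nonpositive the gap is at least `-X (i + 1)`. By independence the
expectation over that event factors, and the two ascent events have probability at least the two
persistence probabilities. -/
lemma IsIID.mul_le_integral_slopeGap (hX : IsIID P X) (hm : ∀ i, Measurable (X i))
    (hi : Integrable (X 0) P) (n i : ℕ) :
    (∫ ω, max (-X 0 ω) 0 ∂P) * (persistenceProb P X i * persistenceProb P X (n - i)) ≤
      ∫ ω, max (slopeGap n (fun l => X l ω) i) 0 ∂P := by
  set A : Ω → ℝ := fun ω => ascent i (revSeq i fun l => X l ω) with hA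
  set B : Ω → ℝ := fun ω => ascent (n - i) (shiftSeq (i + 2) fun l => X l ω) with hB
  have hAm : Measurable A := hX.measurable_ascent_rev hm i
  have hBm : Measurable B := hX.measurable_ascent_shift hm (i + 2) (n - i)
  set f : ℝ × ℝ → ℝ := (Set.Iic 0 ×ˢ Set.Iic 0).indicator 1 with hf
  have hfm : Measurable f := measurable_one.indicator (measurableSet_Iic.prod measurableSet_Iic)
  have hgm : Measurable fun x : ℝ => max (-x) 0 := measurable_id.neg.max measurable_const
  have hind : IndepFun (fun ω => f (A ω, B ω)) (fun ω => max (-X (i + 1) ω) 0) P :=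
    (hX.indepFun_pair_ascent hm i (n - i)).comp hfm hgm
  have h1 := hind.integral_fun_mul_eq_mul_integral
    (hfm.comp (hAm.prodMk hBm)).aestronglyMeasurable (hgm.comp (hm _)).aestronglyMeasurable
  have h2 : ∫ ω, max (-X (i + 1) ω) 0 ∂P = ∫ ω, max (-X 0 ω) 0 ∂P :=
    ((hX.ident (i + 1)).comp hgm).integral_eq
  have h3 : ∫ ω, f (A ω, B ω) ∂P = P.real {ω | A ω ≤ 0} * P.real {ω | B ω ≤ 0} := by
    have e : (fun ω => f (A ω, B ω)) = (A ⁻¹' Set.Iic 0 ∩ B ⁻¹' Set.Iic 0).indicator 1 := by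
      rfl
    rw [e, integral_indicator_one ((hAm measurableSet_Iic).inter (hBm measurableSet_Iic)),
      measureReal_def, (hX.indepFun_ascent hm i (n - i)).measure_inter_preimage_eq_mul _ _
        measurableSet_Iic measurableSet_Iic, ENNReal.toReal_mul]
    rfl
  have h4 : persistenceProb P X i ≤ P.real {ω | A ω ≤ 0} := by
    refine (persistenceProb_le_ascent i).trans_eq ?_
    exact congrArg ENNReal.toReal
      ((hX.identDistrib_ascent_rev hm i).measure_mem_eq measurableSet_Iic).symm
  have h5 : persistenceProb P X (n - i) ≤ P.real {ω | B ω ≤ 0} := by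
    refine (persistenceProb_le_ascent (n - i)).trans_eq ?_
    exact congrArg ENNReal.toReal
      ((hX.identDistrib_ascent_shift hm (i + 2) (n - i)).measure_mem_eq measurableSet_Iic).symm
  have h6 : 0 ≤ ∫ ω, max (-X 0 ω) 0 ∂P := integral_nonneg fun ω => le_max_right _ _
  calc _ ≤ (∫ ω, max (-X 0 ω) 0 ∂P) * (P.real {ω | A ω ≤ 0} * P.real {ω | B ω ≤ 0}) := by
        gcongr
        exact persistenceProb_nonneg _
    _ = ∫ ω, f (A ω, B ω) * max (-X (i + 1) ω) 0 ∂P := by rw [h1, h2, h3, mul_comm]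
    _ ≤ _ := by
      refine integral_mono_of_nonneg (Filter.Eventually.of_forall fun ω => ?_)
        (hX.integrable_slopeGap hm hi n i) (Filter.Eventually.of_forall fun ω => ?_)
      · exact mul_nonneg (Set.indicator_nonneg (fun _ _ => zero_le_one) _) (le_max_right _ _)
      · simp only [hf, Set.indicator_apply, Set.mem_prod, Set.mem_Iic, Pi.one_apply]
        split_ifs with h
        · rw [one_mul, slopeGap]
          refine max_le_max_right _ ?_
          linarith [h.1, h.2]
        · rw [zero_mul]; exact le_max_right _ _

/-- The convolution square of the persistence probabilities is bounded by the expected range of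
the walk. -/
lemma IsIID.conv_persistenceProb_le (hX : IsIID P X) (hm : ∀ i, Measurable (X i))
    (hi : Integrable (X 0) P) {n : ℕ} {M : Ω → ℝ} (hMi : Integrable M P)
    (hM : ∀ ω, ∀ j ≤ n + 2, |partialSum X j ω| ≤ M ω) :
    (∫ ω, max (-X 0 ω) 0 ∂P) *
      ∑ i ∈ Finset.range (n + 1), persistenceProb P X i * persistenceProb P X (n - i) ≤
      2 * ∫ ω, M ω ∂P := by
  rw [Finset.mul_sum, ← integral_const_mul]
  calc _ ≤ ∑ i ∈ Finset.range (n + 1), ∫ ω, max (slopeGap n (fun l => X l ω) i) 0 ∂P :=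
        Finset.sum_le_sum fun i _ => hX.mul_le_integral_slopeGap hm hi n i
    _ = ∫ ω, ∑ i ∈ Finset.range (n + 1), max (slopeGap n (fun l => X l ω) i) 0 ∂P :=
        (integral_finsetSum _ fun i _ => hX.integrable_slopeGap hm hi n i).symm
    _ ≤ _ := integral_mono (integrable_finsetSum _ fun i _ => hX.integrable_slopeGap hm hi n i)
        (hMi.const_mul 2) fun ω => sum_slopeGap_le (hM ω)

lemma IsIID.integrable_partialSum (hX : IsIID P X) (hi : Integrable (X 0) P) (n : ℕ) :
    Integrable (partialSum X n) P :=
  integrable_finsetSum _ fun i _ => hX.integrable hi i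

lemma IsIID.integral_partialSum (hX : IsIID P X) (hi : Integrable (X 0) P)
    (h0 : ∫ ω, X 0 ω ∂P = 0) (n : ℕ) : ∫ ω, partialSum X n ω ∂P = 0 := by
  unfold partialSum
  rw [integral_finsetSum _ fun i _ => hX.integrable hi i]
  exact Finset.sum_eq_zero fun i _ => (hX.ident i).integral_eq.trans h0

/-- The expected range of slopes is at least half the first absolute moment of the walk. -/
lemma IsIID.integral_abs_le_sum_slopeGap (hX : IsIID P X) (hm : ∀ i, Measurable (X i))
    (hi : Integrable (X 0) P) (h0 : ∫ ω, X 0 ω ∂P = 0) (n : ℕ) :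
    (∫ ω, |partialSum X (n + 1) ω| ∂P) / 2 ≤
      ∑ i ∈ Finset.range (n + 1), ∫ ω, max (slopeGap n (fun l => X l ω) i) 0 ∂P := by
  have hint := hX.integrable_partialSum hi (n + 1)
  -- A centred variable has equal expected positive and negative parts.
  have e1 : (∫ ω, |partialSum X (n + 1) ω| ∂P) / 2 = ∫ ω, max (-partialSum X (n + 1) ω) 0 ∂P := by
    have : ∀ ω, max (-partialSum X (n + 1) ω) 0 =
        (|partialSum X (n + 1) ω| - partialSum X (n + 1) ω) / 2 := by
      intro ω
      rcases le_total 0 (partialSum X (n + 1) ω) with h | h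
      · rw [max_eq_right (by linarith), abs_of_nonneg h]; ring
      · rw [max_eq_left (by linarith), abs_of_nonpos h]; ring
    simp_rw [this]
    rw [integral_div, integral_sub hint.abs hint, hX.integral_partialSum hi h0, sub_zero]
  have hg : Measurable fun x : ℕ → ℝ => max (-walk x (n + 1)) 0 :=
    (measurable_walk (n + 1)).neg.max measurable_const
  -- The walk between times `1` and `n + 2` has the law of the walk at time `n + 1`.
  have e2 : ∫ ω, max (-partialSum X (n + 1) ω) 0 ∂P =
      ∫ ω, max (walk (fun l => X l ω) 1 - walk (fun l => X l ω) (n + 2)) 0 ∂P := by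
    refine (hX.identDistrib hm (add_right_injective 1) Function.injective_id
      hg).integral_eq.symm.trans ?_
    refine integral_congr_ae (Filter.Eventually.of_forall fun ω => ?_)
    have := walk_shiftSeq (fun l => X l ω) 1 (n + 1)
    rw [show 1 + (n + 1) = n + 2 by omega] at this
    simp only [this, sub_add_cancel_left]
    rfl
  rw [e1, e2, ← integral_finsetSum _ fun i _ => hX.integrable_slopeGap hm hi n i]
  exact integral_mono_of_nonneg (Filter.Eventually.of_forall fun ω => le_max_right _ _)
    (integrable_finsetSum _ fun i _ => hX.integrable_slopeGap hm hi n i)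
    (Filter.Eventually.of_forall fun ω => le_sum_slopeGap n _)

end
open scoped ENNReal

/-! ### The decay assumption and expected overshoots. -/

section

variable {Ω : Type*} [MeasurableSpace Ω] {P : Measure Ω} [IsProbabilityMeasure P]

/-- A variable that is essentially bounded below, and negative with positive probability, has
exponentially small lower tails, relative to some `P (-Z > δ) > 0`. -/
lemma exists_le_rpow_of_bddBelow {Z : Ω → ℝ} {r : ℝ} (hr : P.real {ω | -Z ω > r} = 0)
    (hneg : 0 < P {ω | Z ω < 0}) :
    ∃ δ θ L : ℝ, 0 < δ ∧ 1 / δ < θ ∧ 0 ≤ L ∧ 0 < P.real {ω | -Z ω > δ} ∧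
      ∀ u : ℝ, 0 < u → P.real {ω | -Z ω > u} ≤ L * P.real {ω | -Z ω > δ} ^ (θ * u) := by
  obtain ⟨δ, hδ, hq⟩ : ∃ δ : ℝ, 0 < δ ∧ 0 < P.real {ω | -Z ω > δ} := by
    by_contra! h
    have hn : ∀ n : ℕ, P {ω | -Z ω > 1 / ((n : ℝ) + 1)} = 0 := fun n =>
      (measureReal_eq_zero_iff).1 (le_antisymm (h _ (by positivity)) measureReal_nonneg)
    have hu : {ω | Z ω < 0} = ⋃ n : ℕ, {ω | -Z ω > 1 / ((n : ℝ) + 1)} := by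
      ext ω
      simp only [Set.mem_ofPred_eq, Set.mem_iUnion]
      constructor
      · intro hω
        exact exists_nat_one_div_lt (show 0 < -Z ω by linarith)
      · rintro ⟨n, hω⟩
        have : 0 < 1 / ((n : ℝ) + 1) := by positivity
        linarith
    rw [hu, measure_iUnion_null hn] at hneg
    exact lt_irrefl _ hneg
  have hq1 : P.real {ω | -Z ω > δ} ≤ 1 := measureReal_le_one
  set q := P.real {ω | -Z ω > δ} with hqdef
  -- Any `θ > 1 / δ` would do. This `L` makes the right side at least `1` for `u < r`, while for `u
  -- ≥ r` the tail vanishes.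
  refine ⟨δ, 2 / δ, (q ^ (2 / δ * r))⁻¹, hδ, by gcongr; norm_num, by positivity, hq, fun u hu => ?_⟩
  rcases le_or_gt r u with h | h
  · have : P.real {ω | -Z ω > u} ≤ P.real {ω | -Z ω > r} :=
      measureReal_mono fun ω hω => lt_of_le_of_lt h hω
    rw [hr] at this
    exact this.trans (by positivity)
  · refine measureReal_le_one.trans ?_
    rw [← div_eq_inv_mul, one_le_div (by positivity)]
    refine Real.rpow_le_rpow_of_exponent_ge hq hq1 ?_
    gcongr

lemma decayAssumption_of_bddBelow {Z : Ω → ℝ} {r : ℝ} (hr : P.real {ω | -Z ω > r} = 0)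
    (hneg : 0 < P {ω | Z ω < 0}) : DecayAssumption P Z := by
  obtain ⟨δ, θ, L, hδ, hθ, _, _, h⟩ := exists_le_rpow_of_bddBelow hr hneg
  refine ⟨δ, θ, 0, L, hδ, hθ, fun t s ht hs => ?_⟩
  rw [zero_mul, zero_mul, zero_add]
  exact h _ (by linarith)

/-- In the decay assumption one may take nonnegative constants and `P (-Z > r) > 0`. -/
lemma DecayAssumption.exists_pos {Z : Ω → ℝ} (h : DecayAssumption P Z)
    (hneg : 0 < P {ω | Z ω < 0}) :
    ∃ r θ K L : ℝ, 0 < r ∧ 1 / r < θ ∧ 0 ≤ K ∧ 0 ≤ L ∧ 0 < P.real {ω | -Z ω > r} ∧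
      ∀ t s : ℝ, 0 < t → 0 < s → P.real {ω | -Z ω > t + s} ≤
        K * P.real {ω | -Z ω > t} * P.real {ω | -Z ω > s} +
          L * P.real {ω | -Z ω > r} ^ (θ * (t + s)) := by
  obtain ⟨r, θ, K, L, hr, hθ, h⟩ := h
  -- A vanishing tail at `r` means that `Z` is essentially bounded below, and the previous
  -- construction supplies a new `r`.
  rcases (measureReal_nonneg (μ := P) (s := {ω | -Z ω > r})).eq_or_lt with h0 | h0
  · obtain ⟨δ, θ', L', hδ, hθ', hL', hq, h'⟩ := exists_le_rpow_of_bddBelow h0.symm hneg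
    refine ⟨δ, θ', 0, L', hδ, hθ', le_rfl, hL', hq, fun t s ht hs => ?_⟩
    rw [zero_mul, zero_mul, zero_add]
    exact h' _ (by linarith)
  · refine ⟨r, θ, |K|, |L|, hr, hθ, abs_nonneg _, abs_nonneg _, h0, fun t s ht hs => ?_⟩
    refine (h t s ht hs).trans ?_
    gcongr <;> exact le_abs_self _

/-- The expected overshoot of `ξ` above `a + b` splits into a product of tail functions. -/
lemma exists_lintegral_overshoot_le {ξ : Ω → ℝ} (hξ : Integrable ξ P) {q θ K L : ℝ}
    (hq0 : 0 < q) (hq1 : q < 1) (hθ : 0 < θ) (hK : 0 ≤ K) (hL : 0 ≤ L)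
    (h : ∀ t s : ℝ, 0 < t → 0 < s → P.real {ω | ξ ω > t + s} ≤
        K * P.real {ω | ξ ω > t} * P.real {ω | ξ ω > s} + L * q ^ (θ * (t + s))) :
    ∃ C : ℝ≥0∞, C ≠ ∞ ∧ ∀ a b : ℝ, 0 ≤ a → 0 ≤ b →
      ∫⁻ ω, ENNReal.ofReal (ξ ω - a - b) ∂P ≤
        C * (ENNReal.ofReal (P.real {ω | ξ ω > a} + q ^ (θ * a)) *
          ENNReal.ofReal (P.real {ω | ξ ω > b} + q ^ (θ * b))) := by
  set F : ℝ → ℝ := fun t => P.real {ω | ξ ω > t} with hF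
  have hF0 : ∀ t, 0 ≤ F t := fun t => measureReal_nonneg
  have hFanti : Antitone F := fun s t hst => measureReal_mono fun ω hω => lt_of_le_of_lt hst hω
  -- The tail at `a + b + w` is split twice: into `a + w / 2` and `b + w / 2`, then the latter into
  -- `b + w / 4` and `w / 4`. The factors in `a` and `b` come out, and `g` collects an integrable
  -- remainder in `w`.
  set g : ℝ → ℝ := fun w => K ^ 2 * F (w / 4) + (K * L + L) * q ^ (θ * (w / 2)) with hg
  have hlayer : ∀ f : Ω → ℝ, AEMeasurable f P → ∫⁻ ω, ENNReal.ofReal (f ω) ∂P =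
      ∫⁻ w in Set.Ioi 0, P {ω | w < f ω} := by
    intro f hf
    have := lintegral_eq_lintegral_meas_lt P (f := fun ω => max (f ω) 0)
      (Filter.Eventually.of_forall fun ω => le_max_right _ _) (hf.max aemeasurable_const)
    simp only [ENNReal.ofReal_max, ENNReal.ofReal_zero, zero_le, sup_of_le_left] at this
    rw [this]
    refine setLIntegral_congr_fun measurableSet_Ioi fun w hw => ?_
    congr 1
    ext ω
    simp only [Set.mem_ofPred_eq, lt_sup_iff]
    exact ⟨fun h => h.resolve_right (not_lt.2 (le_of_lt hw)), Or.inl⟩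
  have hgm : Measurable F := hFanti.measurable
  refine ⟨∫⁻ w in Set.Ioi 0, ENNReal.ofReal (g w), ?_, fun a b ha hb => ?_⟩
  · have e : ∀ w, ENNReal.ofReal (g w) = ENNReal.ofReal (K ^ 2) * P {ω | w < 4 * ξ ω} +
        ENNReal.ofReal (K * L + L) * ENNReal.ofReal (q ^ (θ * (w / 2))) := by
      intro w
      rw [hg, ENNReal.ofReal_add (mul_nonneg (sq_nonneg _) (hF0 _)) (by positivity),
        ENNReal.ofReal_mul (sq_nonneg _), ENNReal.ofReal_mul (by positivity), hF,
        ofReal_measureReal]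
      congr 4
      ext ω
      simp only [gt_iff_lt]
      rw [div_lt_iff₀ (by norm_num), mul_comm]
    simp_rw [e]
    have hmeas : Measurable fun w : ℝ => P {ω | w < 4 * ξ ω} :=
      Antitone.measurable fun s t hst => measure_mono fun ω hω => lt_of_le_of_lt hst hω
    rw [lintegral_add_left (hmeas.const_mul _), lintegral_const_mul _ hmeas,
      lintegral_const_mul _ (by fun_prop), ← hlayer _ (hξ.aemeasurable.const_mul 4)]
    refine ENNReal.add_ne_top.2 ⟨ENNReal.mul_ne_top ENNReal.ofReal_ne_top ?_,
      ENNReal.mul_ne_top ENNReal.ofReal_ne_top ?_⟩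
    · refine ne_top_of_le_ne_top (hξ.const_mul 4).2.ne (lintegral_mono fun ω => ?_)
      rw [← ofReal_norm]
      exact ENNReal.ofReal_le_ofReal (le_abs_self _)
    · have e2 : ∀ w : ℝ, q ^ (θ * (w / 2)) = Real.exp (-(-(Real.log q) * θ / 2) * w) := by
        intro w
        rw [Real.rpow_def_of_pos hq0]
        ring_nf
      have hlog := Real.log_neg hq0 hq1
      have hi := exp_neg_integrableOn_Ioi 0 (b := -(Real.log q) * θ / 2) (by nlinarith)
      simp_rw [e2]
      refine ne_top_of_le_ne_top hi.2.ne (lintegral_mono fun ω => ?_)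
      rw [← ofReal_norm]
      exact ENNReal.ofReal_le_ofReal (le_abs_self _)
  · rw [hlayer _ ((hξ.aemeasurable.sub_const a).sub_const b),
      ← ENNReal.ofReal_mul (by positivity), mul_comm, ← lintegral_const_mul _ (by fun_prop)]
    refine setLIntegral_mono (by fun_prop) fun w hw => ?_
    have hw' : (0 : ℝ) < w := hw
    rw [← ENNReal.ofReal_mul (by positivity), ← ofReal_measureReal]
    refine ENNReal.ofReal_le_ofReal ?_
    have hset : {ω | w < ξ ω - a - b} = {ω | ξ ω > (a + w / 2) + (b + w / 2)} := by
      ext ω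
      simp only [Set.mem_ofPred_eq]
      constructor <;> intro h <;> linarith
    rw [hset]
    have h1 := h (a + w / 2) (b + w / 2) (by linarith) (by linarith)
    have h2 := h (b + w / 4) (w / 4) (by linarith) (by linarith)
    rw [show b + w / 4 + w / 4 = b + w / 2 by ring] at h2
    have h3 : F (a + w / 2) ≤ F a := hFanti (by linarith)
    have h4 : F (b + w / 4) ≤ F b := hFanti (by linarith)
    have e1 : q ^ (θ * (a + w / 2 + (b + w / 2))) ≤ q ^ (θ * a) * q ^ (θ * b) * q ^ (θ * (w / 2)) := by
      rw [← Real.rpow_add hq0, ← Real.rpow_add hq0]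
      refine Real.rpow_le_rpow_of_exponent_ge hq0 hq1.le ?_
      nlinarith
    have e2 : q ^ (θ * (b + w / 2)) = q ^ (θ * b) * q ^ (θ * (w / 2)) := by
      rw [← Real.rpow_add hq0, mul_add]
    change F (a + w / 2 + (b + w / 2)) ≤ K * F (a + w / 2) * F (b + w / 2) + _ at h1
    change F (b + w / 2) ≤ K * F (b + w / 4) * F (w / 4) + _ at h2
    rw [e2] at h2
    set x := q ^ (θ * a)
    set y := q ^ (θ * b)
    set z := q ^ (θ * (w / 2))
    have hx : 0 ≤ x := by positivity
    have hy : 0 ≤ y := by positivity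
    have hz : 0 ≤ z := by positivity
    calc F (a + w / 2 + (b + w / 2)) ≤ K * F (a + w / 2) * F (b + w / 2) + L * (x * y * z) :=
          h1.trans (by gcongr)
      _ ≤ K * F a * (K * F b * F (w / 4) + L * (y * z)) + L * (x * y * z) := by
          have : F (b + w / 2) ≤ K * F b * F (w / 4) + L * (y * z) :=
            h2.trans (by gcongr)
          gcongr
      _ ≤ (F a + x) * (F b + y) * g w := by
          have ha0 := hF0 a
          have hb0 := hF0 b
          have hw0 := hF0 (w / 4)
          have p1 : F a * F b ≤ (F a + x) * (F b + y) := by gcongr <;> linarith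
          have p2 : F a * y ≤ (F a + x) * (F b + y) := by gcongr <;> linarith
          have p3 : x * y ≤ (F a + x) * (F b + y) := by gcongr <;> linarith
          calc _ = F a * F b * (K ^ 2 * F (w / 4)) + F a * y * (K * L * z) + x * y * (L * z) := by
                ring
            _ ≤ (F a + x) * (F b + y) * (K ^ 2 * F (w / 4)) + (F a + x) * (F b + y) * (K * L * z) +
                (F a + x) * (F b + y) * (L * z) := by gcongr
            _ = _ := by simp only [hg]; ring

/-- The expected overshoot of `ξ` above `A + B`, for independent `ξ`, `A`, `B`. -/
lemma lintegral_overshoot_le {ξ A B : Ω → ℝ} (hξ : Measurable ξ) (hA : Measurable A)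
    (hB : Measurable B) (hA0 : ∀ ω, 0 ≤ A ω) (hB0 : ∀ ω, 0 ≤ B ω)
    (hAB : IndepFun (fun ω => (A ω, B ω)) ξ P) (hAB' : IndepFun A B P) {φ : ℝ → ℝ≥0∞}
    (hφ : Measurable φ) {C : ℝ≥0∞}
    (h : ∀ a b : ℝ, 0 ≤ a → 0 ≤ b → ∫⁻ ω, ENNReal.ofReal (ξ ω - a - b) ∂P ≤ C * (φ a * φ b)) :
    ∫⁻ ω, ENNReal.ofReal (ξ ω - A ω - B ω) ∂P ≤
      C * ((∫⁻ ω, φ (A ω) ∂P) * ∫⁻ ω, φ (B ω) ∂P) := by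
  have hmap := (indepFun_iff_map_prod_eq_prod_map_map (hA.prodMk hB).aemeasurable
    hξ.aemeasurable).1 hAB
  have hG : Measurable fun z : (ℝ × ℝ) × ℝ => ENNReal.ofReal (z.2 - z.1.1 - z.1.2) := by fun_prop
  -- By Fubini `ξ` is integrated first with `A` and `B` frozen.
  have e : ∫⁻ ω, ENNReal.ofReal (ξ ω - A ω - B ω) ∂P =
      ∫⁻ ω, (∫⁻ ω', ENNReal.ofReal (ξ ω' - A ω - B ω) ∂P) ∂P := by
    have := lintegral_map hG ((hA.prodMk hB).prodMk hξ) (μ := P)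
    rw [← this, hmap, lintegral_prod _ hG.aemeasurable, lintegral_map hG.lintegral_prod_right'
      (hA.prodMk hB)]
    refine lintegral_congr fun ω => ?_
    exact lintegral_map (f := fun x => ENNReal.ofReal (x - A ω - B ω)) (by fun_prop) hξ
  have e' := lintegral_mul_eq_lintegral_mul_lintegral_of_indepFun (hφ.comp hA) (hφ.comp hB)
    (hAB'.comp hφ hφ)
  simp only [Function.comp_apply, Pi.mul_apply] at e'
  rw [e, ← e', ← lintegral_const_mul _ (by fun_prop)]
  exact lintegral_mono fun ω => h _ _ (hA0 ω) (hB0 ω)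

end
open scoped ENNReal

/-! ### Upper bounds for the expected slope gaps. -/

section

variable {Ω : Type*} [MeasurableSpace Ω] {P : Measure Ω} [IsProbabilityMeasure P]
  {X : ℕ → Ω → ℝ}

/-- A fresh first step below `-r` lowers the iterated sum at index `j + 1` by more than `(j + 1) *
r`, so it reduces the admissible slope by `r` at the price of one factor `P (-X > r)`. -/
lemma IsIID.mul_ascent_lt_le (hX : IsIID P X) (hm : ∀ i, Measurable (X i)) (r u : ℝ) (m : ℕ) :
    P.real {ω | -X 0 ω > r} * P.real {ω | ascent m (fun l => X l ω) < u + r} ≤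
      P.real {ω | ∀ j ≤ m, area (fun l => X l ω) (j + 1) < (j + 1) * u} := by
  have hS : MeasurableSet {x : ℝ | -x > r} := measurableSet_lt measurable_const measurable_id.neg
  have hind := (hX.indepFun_ascent_shift hm m).measure_inter_preimage_eq_mul _ _
    (measurableSet_Iio (a := u + r)) hS
  have e : P.real {ω | ascent m (fun l => X l ω) < u + r} =
      P.real ((fun ω => ascent m fun l => X (1 + l) ω) ⁻¹' Set.Iio (u + r)) :=
    congrArg ENNReal.toReal
      ((hX.identDistrib_ascent_shift hm 1 m).measure_mem_eq measurableSet_Iio).symm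
  rw [e, mul_comm, measureReal_def, measureReal_def,
    show {ω | -X 0 ω > r} = X 0 ⁻¹' {x : ℝ | -x > r} from rfl, ← ENNReal.toReal_mul, ← hind]
  refine measureReal_mono fun ω hω j hj => ?_
  have h1 : ascent m (shiftSeq 1 fun l => X l ω) < u + r := hω.1
  have h2 : -X 0 ω > r := hω.2
  have h3 := ascent_lt_iff.1 h1 j hj
  have hw : walk (fun l => X l ω) 1 = X 0 ω := by simp [walk]
  have ha : area (fun l => X l ω) 1 = X 0 ω := by simp [area_succ, hw]
  rw [add_comm j, area_shiftSeq, hw, ha]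
  have : (0 : ℝ) < (j : ℝ) + 1 := by positivity
  nlinarith

/-- Relaxing the slope by `(i + 1) * r` costs at most a factor `P (-X > r) ^ (i + 1)`. -/
lemma IsIID.pow_mul_ascent_lt_le (hX : IsIID P X) (hm : ∀ i, Measurable (X i)) {r : ℝ}
    (hr : 0 < r) (m i : ℕ) :
    P.real {ω | -X 0 ω > r} ^ (i + 1) *
      P.real {ω | ascent m (fun l => X l ω) < ((i : ℝ) + 1) * r} ≤ persistenceProb P X m := by
  induction i with
  | zero =>
    have := hX.mul_ascent_lt_le hm r 0 m
    simp only [CharP.cast_eq_zero, zero_add, pow_one, one_mul, mul_zero] at this ⊢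
    refine this.trans (measureReal_mono fun ω hω k hk => ?_)
    obtain ⟨hk1, hk2⟩ := Finset.mem_Icc.1 hk
    have := hω (k - 1) (by omega)
    rwa [Nat.sub_add_cancel hk1] at this
  | succ i ih =>
    refine le_trans ?_ ih
    have h := hX.mul_ascent_lt_le hm r (((i : ℝ) + 1) * r) m
    rw [pow_succ, mul_assoc]
    refine mul_le_mul_of_nonneg_left ?_ (pow_nonneg measureReal_nonneg _)
    rw [show ((i + 1 : ℕ) : ℝ) + 1 = (i : ℝ) + 1 + 1 by push_cast; ring, add_mul _ 1, one_mul]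
    refine h.trans (measureReal_mono fun ω hω => ascent_lt_iff.2 fun j hj => ?_)
    have hu : 0 < ((i : ℝ) + 1) * r := by positivity
    -- The bound at index `j` is wanted with factor `j + 1`, one more than available; since the
    -- slope is positive this is only weaker.
    rcases j with _ | j
    · simpa using hu
    · have := hω j (by omega)
      push_cast
      linarith

/-- The tail evaluated at an independent ascent is the chance that a fresh first step beats it,
which by `persistenceProb_succ` is persistence with one more step. -/
lemma IsIID.lintegral_tail_ascent (hX : IsIID P X) (hm : ∀ i, Measurable (X i)) (m : ℕ) :
    ∫⁻ ω, ENNReal.ofReal (P.real {ω' | -X 0 ω' > ascent m fun l => X l ω}) ∂P =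
      ENNReal.ofReal (persistenceProb P X (m + 1)) := by
  have hA : Measurable fun ω => ascent m fun l => X (1 + l) ω :=
    measurable_ascent_of_lt fun l _ => hm _
  have hmap := (indepFun_iff_map_prod_eq_prod_map_map hA.aemeasurable (hm 0).aemeasurable).1
    (hX.indepFun_ascent_shift hm m)
  have hT : MeasurableSet {z : ℝ × ℝ | z.1 < -z.2} :=
    measurableSet_lt measurable_fst measurable_snd.neg
  have hg : Antitone fun a : ℝ => P {ω' | -X 0 ω' > a} :=
    fun s t hst => measure_mono fun ω hω => lt_of_le_of_lt hst hω
  have e0 : ∀ a : ℝ, ENNReal.ofReal (P.real {ω' | -X 0 ω' > a}) = P {ω' | -X 0 ω' > a} :=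
    fun a => ofReal_measureReal
  simp_rw [e0]
  rw [persistenceProb_succ, ofReal_measureReal]
  have e := Measure.map_apply (μ := P) (hA.prodMk (hm 0)) hT
  rw [show {ω | ascent m (fun l => X (1 + l) ω) < -X 0 ω} =
    (fun ω => (ascent m fun l => X (1 + l) ω, X 0 ω)) ⁻¹' {z : ℝ × ℝ | z.1 < -z.2} from rfl,
    ← e, hmap, Measure.prod_apply hT, lintegral_map (measurable_measure_prodMk_left hT) hA]
  have e2 : ∀ a : ℝ, P.map (X 0) (Prod.mk a ⁻¹' {z : ℝ × ℝ | z.1 < -z.2}) =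
      P {ω' | -X 0 ω' > a} := fun a => Measure.map_apply (hm 0) (measurable_prodMk_left hT)
  simp_rw [e2]
  exact (((hX.identDistrib_ascent_shift hm 1 m).comp hg.measurable).lintegral_eq).symm

/-- Slice by the integer part `i` of the ascent divided by `r`. The integrand is at most `q ^ (θ * r
* i)` on a slice of probability at most `q ^ (-(i + 1))` times the persistence probability. The
geometric series has ratio `q ^ (θ * r - 1)`, less than `1` precisely because `θ > 1 / r`. -/
lemma IsIID.lintegral_rpow_ascent_le (hX : IsIID P X) (hm : ∀ i, Measurable (X i)) {r θ : ℝ}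
    (hr : 0 < r) (hθ : 1 / r < θ) (hq0 : 0 < P.real {ω | -X 0 ω > r})
    (hq1 : P.real {ω | -X 0 ω > r} < 1) :
    ∃ C : ℝ≥0∞, C ≠ ∞ ∧ ∀ m : ℕ,
      ∫⁻ ω, ENNReal.ofReal (P.real {ω | -X 0 ω > r} ^ (θ * ascent m fun l => X l ω)) ∂P ≤
        C * ENNReal.ofReal (persistenceProb P X m) := by
  set q := P.real {ω | -X 0 ω > r} with hq
  have hθ0 : 0 < θ := lt_trans (by positivity) hθ
  have hθr : 0 < θ * r - 1 := by rw [div_lt_iff₀ hr] at hθ; linarith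
  refine ⟨∑' i : ℕ, ENNReal.ofReal (q⁻¹) * ENNReal.ofReal (q ^ (θ * r - 1)) ^ i, ?_, fun m => ?_⟩
  · rw [ENNReal.tsum_mul_left, ENNReal.tsum_geometric]
    refine ENNReal.mul_ne_top ENNReal.ofReal_ne_top (ENNReal.inv_ne_top.2 ?_)
    refine (tsub_pos_iff_lt.2 ?_).ne'
    rw [ENNReal.ofReal_lt_one]
    exact Real.rpow_lt_one hq0.le hq1 hθr
  · have hA : Measurable fun ω => ascent m fun l => X l ω :=
      measurable_ascent_of_lt fun l _ => hm _
    have hpt : ∀ ω, ENNReal.ofReal (q ^ (θ * ascent m fun l => X l ω)) ≤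
        ∑' i : ℕ, {ω | ascent m (fun l => X l ω) < ((i : ℝ) + 1) * r}.indicator
          (fun _ => ENNReal.ofReal (q ^ (θ * r * i))) ω := by
      intro ω
      set a := ascent m fun l => X l ω with ha
      have ha0 : 0 ≤ a := ascent_nonneg _ _
      refine le_trans ?_ (ENNReal.le_tsum ⌊a / r⌋₊)
      rw [Set.indicator_of_mem]
      · refine ENNReal.ofReal_le_ofReal (Real.rpow_le_rpow_of_exponent_ge hq0 hq1.le ?_)
        have := Nat.floor_le (div_nonneg ha0 hr.le)
        rw [le_div_iff₀ hr] at this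
        nlinarith
      · have := Nat.lt_floor_add_one (a / r)
        rwa [div_lt_iff₀ hr] at this
    refine (lintegral_mono hpt).trans ?_
    have hset : ∀ i : ℕ, MeasurableSet {ω | ascent m (fun l => X l ω) < ((i : ℝ) + 1) * r} :=
      fun i => measurableSet_lt hA measurable_const
    rw [lintegral_tsum fun i => (measurable_const.indicator (hset i)).aemeasurable,
      ← ENNReal.tsum_mul_right]
    refine ENNReal.tsum_le_tsum fun i => ?_
    rw [lintegral_indicator_const (hset i), ← ofReal_measureReal, ← ENNReal.ofReal_pow (by positivity),
      ← ENNReal.ofReal_mul (by positivity), ← ENNReal.ofReal_mul (by positivity),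
      ← ENNReal.ofReal_mul (by positivity)]
    refine ENNReal.ofReal_le_ofReal ?_
    have h := hX.pow_mul_ascent_lt_le hm hr m i
    rw [← hq] at h
    have e : q ^ (θ * r * i) = q⁻¹ * (q ^ (θ * r - 1)) ^ i * q ^ (i + 1) := by
      rw [← Real.rpow_natCast, ← Real.rpow_natCast, ← Real.rpow_mul hq0.le, ← Real.rpow_neg_one,
        ← Real.rpow_add hq0, ← Real.rpow_add hq0]
      congr 1; push_cast; ring
    rw [e, mul_assoc]
    exact mul_le_mul_of_nonneg_left h (by positivity)

/-- Under the decay assumption, the probability that the maximum is at an interior point,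
integrated over all slopes, is at most of the order of the product of persistence probabilities. -/
lemma IsIID.exists_integral_slopeGap_le (hX : IsIID P X) (hm : ∀ i, Measurable (X i))
    (hi : Integrable (X 0) P) (hneg : 0 < P {ω | X 0 ω < 0}) (hpos : P {ω | X 0 ω < 0} < 1)
    (hd : DecayAssumption P (X 0)) :
    ∃ C : ℝ, 0 < C ∧ ∀ n i : ℕ, ∫ ω, max (slopeGap n (fun l => X l ω) i) 0 ∂P ≤
      C * (persistenceProb P X i * persistenceProb P X (n - i)) := by
  obtain ⟨r, θ, K, L, hr, hθ, hK, hL, hq0, h⟩ := hd.exists_pos hneg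
  have hq1 : P.real {ω | -X 0 ω > r} < 1 := by
    have : P {ω | -X 0 ω > r} < 1 := by
      refine lt_of_le_of_lt (measure_mono fun ω hω => ?_) hpos
      have : -X 0 ω > r := hω
      change X 0 ω < 0
      linarith
    rw [measureReal_def]
    simpa using (ENNReal.toReal_lt_toReal this.ne_top ENNReal.one_ne_top).2 this
  obtain ⟨C₂, hC₂, h₂⟩ := hX.lintegral_rpow_ascent_le hm hr hθ hq0 hq1
  set q := P.real {ω | -X 0 ω > r} with hq
  have hθ0 : 0 < θ := lt_trans (by positivity) hθ
  obtain ⟨C₁, hC₁, h₁⟩ := exists_lintegral_overshoot_le (ξ := fun ω => -X 0 ω) hi.neg hq0 hq1 hθ0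
    hK hL h
  set φ : ℝ → ℝ≥0∞ := fun a => ENNReal.ofReal (P.real {ω | -X 0 ω > a} + q ^ (θ * a)) with hφ
  have hFm : Measurable fun a : ℝ => P.real {ω | -X 0 ω > a} :=
    Antitone.measurable fun s t hst => measureReal_mono fun ω hω => lt_of_le_of_lt hst hω
  have hφm : Measurable φ := by
    refine (hFm.add ?_).ennreal_ofReal
    fun_prop
  -- The tail term yields persistence up to `m + 1`, hence at most up to `m`; the exponential term
  -- yields the constant `C₂`.
  have hφA : ∀ m, ∫⁻ ω, φ (ascent m fun l => X l ω) ∂P ≤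
      (1 + C₂) * ENNReal.ofReal (persistenceProb P X m) := by
    intro m
    have hA : Measurable fun ω => ascent m fun l => X l ω :=
      measurable_ascent_of_lt fun l _ => hm _
    have e : ∀ a, φ a = ENNReal.ofReal (P.real {ω | -X 0 ω > a}) + ENNReal.ofReal (q ^ (θ * a)) :=
      fun a => ENNReal.ofReal_add measureReal_nonneg (by positivity)
    simp_rw [e]
    have hFA : Measurable fun ω => ENNReal.ofReal
        (P.real {ω' | -X 0 ω' > ascent m fun l => X l ω}) := (hFm.comp hA).ennreal_ofReal
    rw [lintegral_add_left hFA, hX.lintegral_tail_ascent hm, add_mul,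
      one_mul]
    gcongr
    · exact persistenceProb_antitone (Nat.le_succ m)
    · exact h₂ m
  refine ⟨(C₁ * ((1 + C₂) * (1 + C₂))).toReal + 1, by positivity, fun n i => ?_⟩
  have hCtop : C₁ * ((1 + C₂) * (1 + C₂)) ≠ ∞ := by
    have : 1 + C₂ ≠ ∞ := ENNReal.add_ne_top.2 ⟨ENNReal.one_ne_top, hC₂⟩
    exact ENNReal.mul_ne_top hC₁ (ENNReal.mul_ne_top this this)
  have hmain : ∫⁻ ω, ENNReal.ofReal (slopeGap n (fun l => X l ω) i) ∂P ≤
      C₁ * ((1 + C₂) * (1 + C₂)) *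
        ENNReal.ofReal (persistenceProb P X i * persistenceProb P X (n - i)) := by
    refine (lintegral_overshoot_le (ξ := fun ω => -X (i + 1) ω) (φ := φ) (C := C₁) (hm _).neg
      (hX.measurable_ascent_rev hm i) (hX.measurable_ascent_shift hm (i + 2) (n - i))
      (fun ω => ascent_nonneg _ _) (fun ω => ascent_nonneg _ _)
      ((hX.indepFun_pair_ascent hm i (n - i)).comp measurable_id measurable_neg)
      (hX.indepFun_ascent hm i (n - i)) hφm fun a b ha hb => ?_).trans ?_
    · refine le_trans (le_of_eq ?_) (h₁ a b ha hb)
      exact ((hX.ident (i + 1)).comp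
        (u := fun x => ENNReal.ofReal (-x - a - b)) (by fun_prop)).lintegral_eq
    · have e1 : ∫⁻ ω, φ (ascent i (revSeq i fun l => X l ω)) ∂P =
          ∫⁻ ω, φ (ascent i fun l => X l ω) ∂P :=
        ((hX.identDistrib_ascent_rev hm i).comp hφm).lintegral_eq
      have e2 : ∫⁻ ω, φ (ascent (n - i) (shiftSeq (i + 2) fun l => X l ω)) ∂P =
          ∫⁻ ω, φ (ascent (n - i) fun l => X l ω) ∂P :=
        ((hX.identDistrib_ascent_shift hm (i + 2) (n - i)).comp hφm).lintegral_eq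
      rw [e1, e2, ENNReal.ofReal_mul (persistenceProb_nonneg _)]
      calc _ ≤ C₁ * (((1 + C₂) * ENNReal.ofReal (persistenceProb P X i)) *
            ((1 + C₂) * ENNReal.ofReal (persistenceProb P X (n - i)))) := by
              gcongr <;> exact hφA _
        _ = _ := by ring
  have hp : 0 ≤ persistenceProb P X i * persistenceProb P X (n - i) :=
    mul_nonneg (persistenceProb_nonneg _) (persistenceProb_nonneg _)
  have h0 : ∀ ω, 0 ≤ max (slopeGap n (fun l => X l ω) i) 0 := fun ω => le_max_right _ _
  rw [integral_eq_lintegral_of_nonneg_ae (Filter.Eventually.of_forall h0)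
    (hX.integrable_slopeGap hm hi n i).aestronglyMeasurable]
  simp only [ENNReal.ofReal_max, ENNReal.ofReal_zero, zero_le, sup_of_le_left]
  have := ENNReal.toReal_mono (ENNReal.mul_ne_top hCtop ENNReal.ofReal_ne_top) hmain
  rw [ENNReal.toReal_mul, ENNReal.toReal_ofReal hp] at this
  nlinarith

end

/-! ### Maxima and first absolute moments of random walks by truncation. -/

section

variable {Ω : Type*} [MeasurableSpace Ω] {P : Measure Ω} [IsProbabilityMeasure P]
  {X : ℕ → Ω → ℝ}

lemma measurableSet_abs_le {f : Ω → ℝ} (hf : Measurable f) (b : ℝ) :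
    MeasurableSet {ω | |f ω| ≤ b} :=
  measurableSet_le (f := fun ω => |f ω|) hf.norm measurable_const

lemma measurableSet_lt_abs {f : Ω → ℝ} (hf : Measurable f) (b : ℝ) :
    MeasurableSet {ω | b < |f ω|} :=
  measurableSet_lt (g := fun ω => |f ω|) measurable_const hf.norm

lemma IsIID.comp (hX : IsIID P X) {f : ℝ → ℝ} (hf : Measurable f) :
    IsIID P fun i ω => f (X i ω) :=
  ⟨hX.indep.comp (fun _ => f) fun _ => hf, fun i => (hX.ident i).comp hf⟩

lemma IsIID.memLp (hX : IsIID P X) (h2 : MemLp (X 0) 2 P) (i : ℕ) : MemLp (X i) 2 P :=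
  (hX.ident i).memLp_iff.2 h2

lemma IsIID.integral_sq_partialSum (hX : IsIID P X) (h2 : MemLp (X 0) 2 P)
    (h0 : ∫ ω, X 0 ω ∂P = 0) (n : ℕ) :
    ∫ ω, partialSum X n ω ^ 2 ∂P = n * ∫ ω, X 0 ω ^ 2 ∂P := by
  have hi : Integrable (X 0) P := h2.integrable (by norm_num)
  have hS : partialSum X n = ∑ i ∈ Finset.range n, X i := by
    ext ω; simp [partialSum]
  have h := IndepFun.variance_sum (s := Finset.range n) (fun i _ => hX.memLp h2 i)
    (fun i _ j _ hij => hX.indep.indepFun hij)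
  rw [← hS, variance_of_integral_eq_zero (hX.integrable_partialSum hi n).aemeasurable
    (hX.integral_partialSum hi h0 n)] at h
  rw [h, Finset.sum_congr rfl fun i _ => (hX.ident i).variance_eq, Finset.sum_const,
    Finset.card_range, nsmul_eq_mul, variance_of_integral_eq_zero hi.aemeasurable h0]

lemma IsIID.memLp_partialSum (hX : IsIID P X) (h2 : MemLp (X 0) 2 P) (n : ℕ) :
    MemLp (partialSum X n) 2 P :=
  memLp_finsetSum _ fun i _ => hX.memLp h2 i

lemma memLp_runMax (hX : IsIID P X) (h2 : MemLp (X 0) 2 P) (n : ℕ) :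
    MemLp (fun ω => runMax (fun i => X i ω) n) 2 P := by
  induction n with
  | zero => simp only [runMax]; exact MemLp.zero'
  | succ n ih => exact ih.sup (hX.memLp_partialSum h2 (n + 1))

lemma measurable_runMax_of_lt {Ω : Type*} {mΩ : MeasurableSpace Ω} {Z : ℕ → Ω → ℝ} {n : ℕ}
    (h : ∀ l < n, Measurable (Z l)) : Measurable fun ω => runMax (fun i => Z i ω) n := by
  induction n with
  | zero => exact measurable_const
  | succ n ih => exact (ih fun l hl => h l (by omega)).max (measurable_walk_of_lt h)

/-- Doob's `L²` maximal inequality for a random walk. -/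
lemma IsIID.integral_runMax_le (hX : IsIID P X) (hm : ∀ i, Measurable (X i))
    (h2 : MemLp (X 0) 2 P) (h0 : ∫ ω, X 0 ω ∂P = 0) (n : ℕ) :
    ∫ ω, runMax (fun i => X i ω) n ∂P ≤ 2 * Real.sqrt (n * ∫ ω, X 0 ω ^ 2 ∂P) := by
  set m : ℕ → Ω → ℝ := fun k ω => runMax (fun i => X i ω) k with hmdef
  have hmL : ∀ k, MemLp (m k) 2 P := memLp_runMax hX h2
  have hi : Integrable (X 0) P := h2.integrable (by norm_num)
  have hmul : ∀ k, Integrable (fun ω => m k ω * X k ω) P := fun k =>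
    (hmL k).integrable_mul (hX.memLp h2 k)
  -- The running maximum at `k` involves only the steps before `X k`, so the sum in
  -- `sq_runMax_add_le` is a martingale transform with mean zero.
  have hzero : ∀ k, ∫ ω, m k ω * X k ω ∂P = 0 := by
    intro k
    have hind : IndepFun (m k) (X k) P := by
      refine hX.indepFun hm (S := Set.Iio k) (T := {k})
        (Set.disjoint_singleton_right.2 (lt_irrefl k)) ?_ (measurable_iSup_comap rfl)
      exact measurable_runMax_of_lt fun l hl => measurable_iSup_comap hl
    rw [hind.integral_fun_mul_eq_mul_integral (hmL k).1 (hX.memLp h2 k).1,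
      (hX.ident k).integral_eq, h0, mul_zero]
  have hsq := (hmL n).integrable_sq
  have hS2 := (hX.memLp_partialSum h2 n).integrable_sq
  -- The product of maximum and endpoint is at most `m n ^ 2 / 4` plus the squared endpoint.
  have key : ∫ ω, (m n ω ^ 2 / 4 + ∑ k ∈ Finset.range n, m k ω * X k ω) ∂P ≤
      ∫ ω, partialSum X n ω ^ 2 ∂P := by
    refine integral_mono ((hsq.div_const 4).add (integrable_finsetSum _ fun k _ => hmul k)) hS2
      fun ω => ?_
    have h := sq_runMax_add_le (fun i => X i ω) n
    change m n ω ^ 2 / 4 + ∑ k ∈ Finset.range n, m k ω * X k ω ≤ partialSum X n ω ^ 2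
    change m n ω ^ 2 / 2 + ∑ k ∈ Finset.range n, m k ω * X k ω ≤ m n ω * partialSum X n ω at h
    nlinarith [sq_nonneg (m n ω / 2 - partialSum X n ω)]
  rw [integral_add (hsq.div_const 4) (integrable_finsetSum _ fun k _ => hmul k),
    integral_finsetSum _ fun k _ => hmul k, Finset.sum_eq_zero fun k _ => hzero k, add_zero,
    integral_div, hX.integral_sq_partialSum h2 h0] at key
  have hcs : (∫ ω, m n ω ∂P) ^ 2 ≤ ∫ ω, m n ω ^ 2 ∂P := by
    have h := variance_nonneg (m n) P
    rw [variance_eq_sub (hmL n)] at h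
    simpa using h
  have hnn : 0 ≤ n * ∫ ω, X 0 ω ^ 2 ∂P :=
    mul_nonneg (Nat.cast_nonneg n) (integral_nonneg fun ω => sq_nonneg _)
  refine le_of_sq_le_sq ?_ (by positivity)
  rw [mul_pow, Real.sq_sqrt hnn]
  linarith

/-- A bound for the expected maximum of a random walk, by truncation of the steps at `b`. -/
lemma IsIID.exists_maximal_bound (hX : IsIID P X) (hm : ∀ i, Measurable (X i))
    (hi : Integrable (X 0) P) (h0 : ∫ ω, X 0 ω ∂P = 0) (n : ℕ) (b : ℝ) :
    ∃ M : Ω → ℝ, Integrable M P ∧ (∀ ω, ∀ j ≤ n, |partialSum X j ω| ≤ M ω) ∧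
      ∫ ω, M ω ∂P ≤ 4 * Real.sqrt (n * ∫ ω in {ω | |X 0 ω| ≤ b}, X 0 ω ^ 2 ∂P) +
        2 * (n * ∫ ω in {ω | b < |X 0 ω|}, |X 0 ω| ∂P) := by
  have hSm : MeasurableSet {x : ℝ | |x| ≤ b} := measurableSet_le measurable_norm measurable_const
  set f : ℝ → ℝ := {x : ℝ | |x| ≤ b}.indicator id with hf
  have hfm : Measurable f := measurable_id.indicator hSm
  set τ : ℝ := ∫ ω, f (X 0 ω) ∂P with hτ
  set R : ℝ := ∫ ω in {ω | b < |X 0 ω|}, |X 0 ω| ∂P with hR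
  have hfb : ∀ x, |f x| ≤ |b| := by
    intro x
    simp only [hf, Set.indicator_apply]
    split_ifs with h
    · exact le_trans h (le_abs_self b)
    · simp
  have hfL : MemLp (fun ω => f (X 0 ω)) 2 P :=
    MemLp.of_bound (hfm.comp (hm 0)).aestronglyMeasurable |b|
      (Filter.Eventually.of_forall fun ω => hfb _)
  have hfi : ∀ i, Integrable (fun ω => f (X i ω)) P := fun i =>
    (hX.comp hfm).integrable (hfL.integrable (by norm_num)) i
  have hset : ∀ i, ∫ ω, |X i ω - f (X i ω)| ∂P = R := by
    intro i
    have e1 : ∫ ω, |X i ω - f (X i ω)| ∂P = ∫ ω, |X 0 ω - f (X 0 ω)| ∂P :=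
      ((hX.ident i).comp (u := fun x => |x - f x|) (by fun_prop)).integral_eq
    rw [e1, hR, ← integral_indicator (measurableSet_lt_abs (hm 0) b)]
    congr 1
    ext ω
    by_cases h : |X 0 ω| ≤ b
    · simp [hf, h, not_lt.2 h]
    · simp [hf, h, not_le.1 h]
  -- As `X 0` is centred, the mean of the truncated step is minus the mean of the discarded part.
  have hτR : |τ| ≤ R := by
    have e : τ = -∫ ω, (X 0 ω - f (X 0 ω)) ∂P := by
      rw [integral_sub hi (hfi 0), h0, zero_sub, neg_neg]
    rw [e, abs_neg, ← hset 0]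
    exact abs_integral_le_integral_abs
  have hsq : ∫ ω, f (X 0 ω) ^ 2 ∂P = ∫ ω in {ω | |X 0 ω| ≤ b}, X 0 ω ^ 2 ∂P := by
    rw [← integral_indicator (measurableSet_abs_le (hm 0) b)]
    congr 1
    ext ω
    by_cases h : |X 0 ω| ≤ b <;> simp [hf, h]
  -- `runMax` is one-sided; the signs `1` and `-1` together control the absolute value.
  have hbound : ∀ ε : ℝ, ε ^ 2 = 1 →
      MemLp (fun ω => runMax (fun i => ε * (f (X i ω) - τ)) n) 2 P ∧
      ∫ ω, runMax (fun i => ε * (f (X i ω) - τ)) n ∂P ≤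
        2 * Real.sqrt (n * ∫ ω in {ω | |X 0 ω| ≤ b}, X 0 ω ^ 2 ∂P) := by
    intro ε hε
    have hum : Measurable fun x => ε * (f x - τ) := by fun_prop
    have hW := hX.comp hum
    have hWL : MemLp (fun ω => ε * (f (X 0 ω) - τ)) 2 P := (hfL.sub (memLp_const τ)).const_mul ε
    refine ⟨memLp_runMax hW hWL n, ?_⟩
    have hW0 : ∫ ω, ε * (f (X 0 ω) - τ) ∂P = 0 := by
      rw [integral_const_mul, integral_sub (hfi 0) (integrable_const _)]
      simp [hτ]
    refine (hW.integral_runMax_le (fun i => hum.comp (hm i)) hWL hW0 n).trans ?_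
    gcongr
    rw [← hsq]
    have e : ∀ ω, (ε * (f (X 0 ω) - τ)) ^ 2 = (f (X 0 ω) - τ) ^ 2 := fun ω => by
      rw [mul_pow, hε, one_mul]
    simp_rw [e]
    have hv := variance_eq_integral (μ := P) hfL.1.aemeasurable
    have hv' := variance_eq_sub hfL
    rw [← hτ] at hv hv'
    rw [← hv, hv']
    simp only [Pi.pow_apply]
    linarith [sq_nonneg τ]
  obtain ⟨hL1, hB1⟩ := hbound 1 (by norm_num)
  obtain ⟨hL2, hB2⟩ := hbound (-1) (by norm_num)
  have hI1 := hL1.integrable (by norm_num)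
  have hI2 := hL2.integrable (by norm_num)
  have hI5 : ∀ i, Integrable (fun ω => |X i ω - f (X i ω)|) P := fun i =>
    ((hX.integrable hi i).sub (hfi i)).abs
  have hI4 : ∀ i, Integrable (fun ω => |X i ω - f (X i ω)| + |τ|) P := fun i =>
    (hI5 i).add (integrable_const _)
  have hI3 : Integrable (fun ω => ∑ i ∈ Finset.range n, (|X i ω - f (X i ω)| + |τ|)) P :=
    integrable_finsetSum _ fun i _ => hI4 i
  refine ⟨fun ω => runMax (fun i => 1 * (f (X i ω) - τ)) n +
    runMax (fun i => (-1) * (f (X i ω) - τ)) n +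
    ∑ i ∈ Finset.range n, (|X i ω - f (X i ω)| + |τ|), (hI1.add hI2).add hI3, ?_, ?_⟩
  · intro ω j hj
    have e1 := walk_le_runMax (fun i => 1 * (f (X i ω) - τ)) hj
    have e2 := walk_le_runMax (fun i => (-1) * (f (X i ω) - τ)) hj
    have e3 := runMax_nonneg (fun i => 1 * (f (X i ω) - τ)) n
    have e4 := runMax_nonneg (fun i => (-1) * (f (X i ω) - τ)) n
    simp only [walk, ← Finset.mul_sum] at e1 e2
    have e5 : partialSum X j ω = ∑ i ∈ Finset.range j, (f (X i ω) - τ) +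
        ∑ i ∈ Finset.range j, ((X i ω - f (X i ω)) + τ) := by
      rw [← Finset.sum_add_distrib, partialSum]
      exact Finset.sum_congr rfl fun i _ => by ring
    have e6 : |∑ i ∈ Finset.range j, ((X i ω - f (X i ω)) + τ)| ≤
        ∑ i ∈ Finset.range n, (|X i ω - f (X i ω)| + |τ|) :=
      (Finset.abs_sum_le_sum_abs _ _).trans <|
        (Finset.sum_le_sum fun i _ => abs_add_le _ _).trans <|
        Finset.sum_le_sum_of_subset_of_nonneg (Finset.range_mono hj) fun i _ _ => by positivity
    rw [e5]
    rw [abs_le] at e6 ⊢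
    constructor <;> linarith [e6.1, e6.2]
  · have hI12 : Integrable (fun ω => runMax (fun i => 1 * (f (X i ω) - τ)) n +
        runMax (fun i => (-1) * (f (X i ω) - τ)) n) P := hI1.add hI2
    rw [integral_add hI12 hI3, integral_add hI1 hI2, integral_finsetSum _ fun i _ =>
      hI4 i]
    have e : ∀ i ∈ Finset.range n, ∫ ω, (|X i ω - f (X i ω)| + |τ|) ∂P ≤ 2 * R := by
      intro i _
      rw [integral_add (hI5 i) (integrable_const _), hset i]
      simp only [integral_const, probReal_univ, one_smul]
      linarith
    have := Finset.sum_le_sum e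
    rw [Finset.sum_const, Finset.card_range, nsmul_eq_mul] at this
    linarith

/-- A lower bound for the first absolute moment of a random walk by the truncated second moment
of its steps. -/
lemma IsIID.le_integral_abs_partialSum (hX : IsIID P X) (hm : ∀ i, Measurable (X i))
    (hi : Integrable (X 0) P) (h0 : ∫ ω, X 0 ω ∂P = 0) {n : ℕ} {b : ℝ} (hb : 0 < b)
    (hS : ∫ ω, |partialSum X n ω| ∂P + ∫ ω, |X 0 ω| ∂P ≤ b / 4) :
    n / (2 * b) * ∫ ω in {ω | |X 0 ω| ≤ b / 2}, X 0 ω ^ 2 ∂P ≤ ∫ ω, |partialSum X n ω| ∂P := by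
  -- Since `|φ| ≤ 1`, the first absolute moment of the sum `S` is at least the mean of `S * φ S`,
  -- which is expanded over the steps.
  set φ : ℝ → ℝ := fun s => max (-1) (min 1 (s / b)) with hφ
  have hφm : Measurable φ := by fun_prop
  have hφ1 : ∀ s, |φ s| ≤ 1 := fun s => abs_le.2 ⟨le_max_left _ _,
    max_le (by norm_num) (min_le_left _ _)⟩
  have hφmono : Monotone φ := fun s t hst => max_le_max_left _ (min_le_min_left _ (by gcongr))
  have hφlin : ∀ s, |s| ≤ b → φ s = s / b := by
    intro s hs
    obtain ⟨h1, h2⟩ := abs_le.1 hs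
    have h3 : s / b ≤ 1 := by rw [div_le_one hb]; exact h2
    have h4 : -1 ≤ s / b := by rw [le_div_iff₀ hb]; linarith
    simp [hφ, min_eq_right h3, max_eq_right h4]
  have hint : ∀ i, Integrable (X i) P := hX.integrable hi
  have hSn := hX.integrable_partialSum hi n
  have hSm : ∀ k, Measurable (partialSum X k) := fun k => measurable_walk_of_lt fun l _ => hm l
  have hmulφ : ∀ i, ∀ g : Ω → ℝ, Measurable g → Integrable (fun ω => X i ω * φ (g ω)) P := by
    intro i g hg
    refine (hint i).mul_bdd (c := 1) (hφm.comp hg).aestronglyMeasurable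
      (Filter.Eventually.of_forall fun ω => hφ1 _)
  set T : ℝ := ∫ ω in {ω | |X 0 ω| ≤ b / 2}, X 0 ω ^ 2 ∂P with hT
  have hterm : ∀ i ∈ Finset.range n, T / (2 * b) ≤ ∫ ω, X i ω * φ (partialSum X n ω) ∂P := by
    -- Leave-one-out: `D`, the sum without step `i`, is independent of `X i`, so `X i * φ D` has
    -- mean zero and may be subtracted. The difference is nonnegative by monotonicity of `φ` and
    -- equals `X i ^ 2 / b` when both `|X i|` and `|D|` are at most `b / 2`; by Markov the latter
    -- has probability at least `1 / 2`.
    intro i hin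
    set D : Ω → ℝ := fun ω => ∑ l ∈ (Finset.range n).erase i, X l ω with hD
    have hDm : Measurable D := Finset.measurable_sum _ fun l _ => hm l
    have hDS : ∀ ω, partialSum X n ω = X i ω + D ω := fun ω =>
      (Finset.add_sum_erase _ (fun l => X l ω) hin).symm
    have hDX : IndepFun D (X i) P := by
      refine hX.indepFun hm (S := {i}ᶜ) (T := {i}) disjoint_compl_left ?_
        (measurable_iSup_comap rfl)
      exact Finset.measurable_sum _ fun l hl => measurable_iSup_comap (Finset.ne_of_mem_erase hl)
    have hzero : ∫ ω, X i ω * φ (D ω) ∂P = 0 := by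
      have := (hDX.symm.comp measurable_id hφm).integral_fun_mul_eq_mul_integral
        (hm i).aestronglyMeasurable (hφm.comp hDm).aestronglyMeasurable
      simp only [Function.comp_apply, id_eq] at this
      rw [this, (hX.ident i).integral_eq, h0, zero_mul]
    have hDi : Integrable D P := integrable_finsetSum _ fun l _ => hint l
    have hDabs : ∫ ω, |D ω| ∂P ≤ b / 4 := by
      refine le_trans ?_ hS
      have e : ∫ ω, |X i ω| ∂P = ∫ ω, |X 0 ω| ∂P :=
        ((hX.ident i).comp (u := fun x => |x|) measurable_norm).integral_eq
      rw [← e, ← integral_add hSn.abs (hint i).abs]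
      refine integral_mono hDi.abs (hSn.abs.add (hint i).abs) fun ω => ?_
      have : D ω = partialSum X n ω - X i ω := by rw [hDS]; ring
      change |D ω| ≤ |partialSum X n ω| + |X i ω|
      rw [this]
      exact abs_sub _ _
    have hprob : 1 / 2 ≤ P.real {ω | |D ω| ≤ b / 2} := by
      have h1 := mul_meas_ge_le_integral_of_nonneg (μ := P) (f := fun ω => |D ω|)
        (Filter.Eventually.of_forall fun ω => abs_nonneg _) hDi.abs (b / 2)
      have h2 : P.real {ω | |D ω| ≤ b / 2}ᶜ ≤ P.real {ω | b / 2 ≤ |D ω|} :=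
        measureReal_mono fun ω (hω : ¬ |D ω| ≤ b / 2) => (not_le.1 hω).le
      rw [probReal_compl_eq_one_sub (measurableSet_abs_le hDm (b / 2))] at h2
      have h3 : b / 2 * P.real {ω | b / 2 ≤ |D ω|} ≤ b / 2 * (1 / 2) := by linarith
      have h4 := le_of_mul_le_mul_left h3 (by linarith)
      linarith
    set u : ℝ → ℝ := {x : ℝ | |x| ≤ b / 2}.indicator (fun x => x ^ 2) with hu
    set v : ℝ → ℝ := {x : ℝ | |x| ≤ b / 2}.indicator 1 with hv
    have hsetm : MeasurableSet {x : ℝ | |x| ≤ b / 2} :=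
      measurableSet_le measurable_norm measurable_const
    have hum : Measurable u := (measurable_id.pow_const 2).indicator hsetm
    have hvm : Measurable v := measurable_one.indicator hsetm
    have huT : ∫ ω, u (X i ω) ∂P = T := by
      have e : ∫ ω, u (X i ω) ∂P = ∫ ω, u (X 0 ω) ∂P := ((hX.ident i).comp hum).integral_eq
      rw [e, hT, ← integral_indicator (measurableSet_abs_le (hm 0) (b / 2))]
      rfl
    have hvP : ∫ ω, v (D ω) ∂P = P.real {ω | |D ω| ≤ b / 2} := by
      rw [← integral_indicator_one (measurableSet_abs_le hDm (b / 2))]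
      rfl
    have huv := (hDX.symm.comp hum hvm).integral_fun_mul_eq_mul_integral
      (hum.comp (hm i)).aestronglyMeasurable (hvm.comp hDm).aestronglyMeasurable
    simp only [Function.comp_apply] at huv
    rw [huT, hvP] at huv
    have hT0 : 0 ≤ T := integral_nonneg fun ω => sq_nonneg _
    calc T / (2 * b) = T * (1 / 2) / b := by field_simp
      _ ≤ T * P.real {ω | |D ω| ≤ b / 2} / b := by gcongr
      _ = ∫ ω, u (X i ω) * v (D ω) / b ∂P := by rw [integral_div, huv]
      _ ≤ ∫ ω, (X i ω * φ (partialSum X n ω) - X i ω * φ (D ω)) ∂P := by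
        refine integral_mono_of_nonneg (Filter.Eventually.of_forall fun ω => ?_)
          ((hmulφ i _ (hSm n)).sub (hmulφ i _ hDm)) (Filter.Eventually.of_forall fun ω => ?_)
        · exact div_nonneg (mul_nonneg (Set.indicator_nonneg (fun _ _ => sq_nonneg _) _)
            (Set.indicator_nonneg (fun _ _ => zero_le_one) _)) hb.le
        · change u (X i ω) * v (D ω) / b ≤ X i ω * φ (partialSum X n ω) - X i ω * φ (D ω)
          rw [hDS ω, ← mul_sub]
          have hnn : 0 ≤ X i ω * (φ (X i ω + D ω) - φ (D ω)) := by
            rcases le_total 0 (X i ω) with h | h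
            · exact mul_nonneg h (sub_nonneg.2 (hφmono (by linarith)))
            · exact mul_nonneg_of_nonpos_of_nonpos h (sub_nonpos.2 (hφmono (by linarith)))
          by_cases h1 : |X i ω| ≤ b / 2
          · by_cases h2 : |D ω| ≤ b / 2
            · rw [hφlin _ ((abs_add_le _ _).trans (by linarith)), hφlin (D ω) (by linarith)]
              simp only [hu, hv, Set.indicator_apply, Set.mem_ofPred_eq, h1, h2, if_true,
                Pi.one_apply]
              apply le_of_eq
              ring
            · simpa [hu, hv, Set.indicator_apply, h2] using hnn
          · simpa [hu, hv, Set.indicator_apply, h1] using hnn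
      _ = _ := by rw [integral_sub (hmulφ i _ (hSm n)) (hmulφ i _ hDm), hzero, sub_zero]
  have hsum := Finset.sum_le_sum hterm
  rw [Finset.sum_const, Finset.card_range, nsmul_eq_mul,
    ← integral_finsetSum _ fun i _ => hmulφ i _ (hSm n)] at hsum
  calc n / (2 * b) * T = n * (T / (2 * b)) := by ring
    _ ≤ _ := hsum
    _ ≤ ∫ ω, |partialSum X n ω| ∂P := by
      refine integral_mono (integrable_finsetSum _ fun i _ => hmulφ i _ (hSm n)) hSn.abs fun ω => ?_
      change ∑ i ∈ Finset.range n, X i ω * φ (partialSum X n ω) ≤ |partialSum X n ω|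
      rw [← Finset.sum_mul]
      change partialSum X n ω * φ (partialSum X n ω) ≤ _
      refine (le_abs_self _).trans ?_
      rw [abs_mul]
      exact mul_le_of_le_one_right (abs_nonneg _) (hφ1 _)

end

/-! ### Orders of magnitude under tail scaling. -/

section

variable {Ω : Type*} [MeasurableSpace Ω] {P : Measure Ω} [IsProbabilityMeasure P]
  {X : ℕ → Ω → ℝ}

/-- The truncated second moments of `Z` are of order `b ^ (2 - α)`, and the tail expectations
at most of order `b ^ (1 - α)`. -/
def TailScaling (P : Measure Ω) (Z : Ω → ℝ) (α : ℝ) : Prop :=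
  ∃ b₀ c C : ℝ, 0 < b₀ ∧ 0 < c ∧ 0 < C ∧ ∀ b : ℝ, b₀ ≤ b →
    c * b ^ (2 - α) ≤ ∫ ω in {ω | |Z ω| ≤ b}, Z ω ^ 2 ∂P ∧
    ∫ ω in {ω | |Z ω| ≤ b}, Z ω ^ 2 ∂P ≤ C * b ^ (2 - α) ∧
    ∫ ω in {ω | b < |Z ω|}, |Z ω| ∂P ≤ C * b ^ (1 - α)

/-- At the truncation level `b = A * n ^ (1 / α)` the number of steps is a multiple of `b ^ α`, so
`n * b ^ (2 - α)` is of order `b ^ 2` and `n * b ^ (1 - α)` of order `b`. -/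
lemma natCast_eq_rpow_mul {α A : ℝ} (hα : 0 < α) (hA : 0 < A) (n : ℕ) :
    (n : ℝ) = A ^ (-α) * (A * (n : ℝ) ^ (1 / α)) ^ α := by
  rw [Real.mul_rpow hA.le (by positivity), ← Real.rpow_mul (Nat.cast_nonneg n),
    one_div_mul_cancel hα.ne', Real.rpow_one, ← mul_assoc, ← Real.rpow_add hA, neg_add_cancel,
    Real.rpow_zero, one_mul]

lemma IsIID.exists_maximal_bound_rpow (hX : IsIID P X) (hm : ∀ i, Measurable (X i))
    (hi : Integrable (X 0) P) (h0 : ∫ ω, X 0 ω ∂P = 0) {α : ℝ} (hα : 1 < α)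
    (hs : TailScaling P (X 0) α) :
    ∃ C : ℝ, 0 < C ∧ ∀ n : ℕ, 1 ≤ n → ∃ M : Ω → ℝ, Integrable M P ∧
      (∀ ω, ∀ j ≤ n, |partialSum X j ω| ≤ M ω) ∧ ∫ ω, M ω ∂P ≤ C * (n : ℝ) ^ (1 / α) := by
  obtain ⟨b₀, c, C, hb₀, hc, hC, h⟩ := hs
  have hα0 : 0 < α := by linarith
  set κ : ℝ := b₀ ^ (-α) with hκ
  have hκ0 : 0 < κ := Real.rpow_pos_of_pos hb₀ _
  refine ⟨(4 * Real.sqrt (κ * C) + 2 * (κ * C)) * b₀, by positivity, fun n hn => ?_⟩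
  have hn1 : (1 : ℝ) ≤ (n : ℝ) ^ (1 / α) :=
    Real.one_le_rpow (by exact_mod_cast hn) (by positivity)
  set b : ℝ := b₀ * (n : ℝ) ^ (1 / α) with hb
  have hbb : b₀ ≤ b := le_mul_of_one_le_right hb₀.le hn1
  have hb0 : 0 < b := hb₀.trans_le hbb
  have hnb : (n : ℝ) = κ * b ^ α := natCast_eq_rpow_mul hα0 hb₀ n
  obtain ⟨-, hT, hR⟩ := h b hbb
  obtain ⟨M, hMi, hM, hMb⟩ := hX.exists_maximal_bound hm hi h0 n b
  refine ⟨M, hMi, hM, hMb.trans ?_⟩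
  have e1 : (n : ℝ) * (C * b ^ (2 - α)) = κ * C * b ^ 2 := by
    have : b ^ α * b ^ (2 - α) = b ^ 2 := by
      rw [← Real.rpow_add hb0, ← Real.rpow_natCast]; congr 1; push_cast; ring
    rw [hnb, ← this]; ring
  have e2 : (n : ℝ) * (C * b ^ (1 - α)) = κ * C * b := by
    have : b ^ α * b ^ (1 - α) = b := by
      rw [← Real.rpow_add hb0, add_sub_cancel, Real.rpow_one]
    calc _ = κ * C * (b ^ α * b ^ (1 - α)) := by rw [hnb]; ring
      _ = _ := by rw [this]
  calc _ ≤ 4 * Real.sqrt (n * (C * b ^ (2 - α))) + 2 * (n * (C * b ^ (1 - α))) := by gcongr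
    _ = (4 * Real.sqrt (κ * C) + 2 * (κ * C)) * b := by
      rw [e1, e2, Real.sqrt_mul (by positivity), Real.sqrt_sq hb0.le]; ring
    _ = _ := by rw [hb]; ring

/-- The first absolute moments of a centred walk with regularly behaved tails. -/
lemma IsIID.sameOrder_integral_abs (hX : IsIID P X) (hm : ∀ i, Measurable (X i))
    (hi : Integrable (X 0) P) (h0 : ∫ ω, X 0 ω ∂P = 0) {α : ℝ} (hα : 1 < α)
    (hs : TailScaling P (X 0) α) :
    SameOrder (fun n => ∫ ω, |partialSum X n ω| ∂P) (fun n => (n : ℝ) ^ (1 / α)) := by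
  obtain ⟨D, hD, hmax⟩ := hX.exists_maximal_bound_rpow hm hi h0 hα hs
  have hup : ∀ n : ℕ, 1 ≤ n → ∫ ω, |partialSum X n ω| ∂P ≤ D * (n : ℝ) ^ (1 / α) := by
    intro n hn
    obtain ⟨M, hMi, hM, hMb⟩ := hmax n hn
    exact (integral_mono (hX.integrable_partialSum hi n).abs hMi fun ω => hM ω n le_rfl).trans hMb
  obtain ⟨b₀, c, C, hb₀, hc, hC, h⟩ := hs
  have hα0 : 0 < α := by linarith
  set E : ℝ := ∫ ω, |X 0 ω| ∂P with hE
  have hE0 : 0 ≤ E := integral_nonneg fun ω => abs_nonneg _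
  -- The first summand puts `b / 2` in the scaling range; the second gives the moment condition of
  -- `IsIID.le_integral_abs_partialSum`, thanks to the upper bound already proved.
  set A : ℝ := 2 * b₀ + 4 * (D + E) with hA
  have hA0 : 0 < A := by positivity
  refine ⟨A ^ (-α) * c * (1 / 2) ^ (2 - α) / 2 * A, D, by positivity, hD,
    fun n hn => ⟨?_, hup n hn⟩⟩
  have hn1 : (1 : ℝ) ≤ (n : ℝ) ^ (1 / α) :=
    Real.one_le_rpow (by exact_mod_cast hn) (by positivity)
  set b : ℝ := A * (n : ℝ) ^ (1 / α) with hb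
  have hbA : A ≤ b := le_mul_of_one_le_right hA0.le hn1
  have hb0 : 0 < b := hA0.trans_le hbA
  have hnb : (n : ℝ) = A ^ (-α) * b ^ α := natCast_eq_rpow_mul hα0 hA0 n
  have hbound : ∫ ω, |partialSum X n ω| ∂P + E ≤ b / 4 := by
    have h1 := hup n hn
    have h2 : E ≤ E * (n : ℝ) ^ (1 / α) := le_mul_of_one_le_right hE0 hn1
    have h3 : (4 * (D + E)) * (n : ℝ) ^ (1 / α) ≤ b := by
      rw [hb]; gcongr; linarith
    linarith
  refine le_trans ?_ (hX.le_integral_abs_partialSum hm hi h0 hb0 hbound)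
  have hT := (h (b / 2) (by linarith)).1
  have e1 : (b / 2) ^ (2 - α) = b ^ (2 - α) * (1 / 2) ^ (2 - α) := by
    rw [← Real.mul_rpow hb0.le (by norm_num)]; congr 1; ring
  have e2 : b ^ α * b ^ (2 - α) = b * b := by
    rw [← Real.rpow_add hb0, ← sq, ← Real.rpow_natCast]; congr 1; push_cast; ring
  calc A ^ (-α) * c * (1 / 2) ^ (2 - α) / 2 * A * (n : ℝ) ^ (1 / α)
      = A ^ (-α) * c * (1 / 2) ^ (2 - α) / 2 * b := by rw [hb]; ring
    _ = A ^ (-α) * c * (1 / 2) ^ (2 - α) * (b ^ α * b ^ (2 - α)) / (2 * b) := by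
      rw [e2]; field_simp
    _ = n / (2 * b) * (c * (b / 2) ^ (2 - α)) := by rw [e1, hnb]; ring
    _ ≤ _ := by gcongr

lemma measure_neg_pos {Z : Ω → ℝ} (hi : Integrable Z P) (h0 : ∫ ω, Z ω ∂P = 0)
    (hne : ¬ Z =ᵐ[P] 0) : 0 < P {ω | Z ω < 0} := by
  refine pos_iff_ne_zero.2 fun h => hne ?_
  have hnn : 0 ≤ᵐ[P] Z := by
    filter_upwards [measure_eq_zero_iff_ae_notMem.1 h] with ω hω
    exact not_lt.1 hω
  exact (integral_eq_zero_iff_of_nonneg_ae hnn hi).1 h0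

lemma measure_neg_lt_one {Z : Ω → ℝ} (hm : Measurable Z) (hi : Integrable Z P)
    (h0 : ∫ ω, Z ω ∂P = 0) (hne : ¬ Z =ᵐ[P] 0) : P {ω | Z ω < 0} < 1 := by
  have h : 0 < P {ω | -Z ω < 0} := by
    refine measure_neg_pos hi.neg (by rw [integral_neg, h0, neg_zero])
      fun h => hne ?_
    filter_upwards [h] with ω hω
    simpa using hω
  refine prob_le_one.lt_of_ne fun h1 => h.ne' ?_
  rw [← prob_compl_eq_zero_iff (measurableSet_lt hm measurable_const)] at h1
  refine measure_mono_null (fun ω (hω : -Z ω < 0) => ?_) h1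
  change ¬ Z ω < 0
  linarith

lemma integral_negPart_pos {Z : Ω → ℝ} (hi : Integrable Z P) (h0 : ∫ ω, Z ω ∂P = 0)
    (hne : ¬ Z =ᵐ[P] 0) : 0 < ∫ ω, max (-Z ω) 0 ∂P := by
  have hnn : 0 ≤ fun ω => max (-Z ω) 0 := fun ω => le_max_right _ _
  refine (integral_nonneg hnn).lt_of_ne fun h => (measure_neg_pos hi h0 hne).ne' ?_
  have := (integral_eq_zero_iff_of_nonneg hnn hi.neg.pos_part).1 h.symm
  rw [measure_eq_zero_iff_ae_notMem]
  filter_upwards [this] with ω hω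
  have h1 : max (-Z ω) 0 = 0 := hω
  have h2 := le_max_left (-Z ω) 0
  change ¬ Z ω < 0
  linarith

lemma TailScaling.not_ae_zero {Z : Ω → ℝ} {α : ℝ} (hs : TailScaling P Z α) : ¬ Z =ᵐ[P] 0 := by
  rintro h
  obtain ⟨b₀, c, C, hb₀, hc, hC, hs⟩ := hs
  have h1 := (hs b₀ le_rfl).1
  have h2 : ∫ ω in {ω | |Z ω| ≤ b₀}, Z ω ^ 2 ∂P = 0 := by
    rw [integral_congr_ae (g := fun _ => 0)]
    · simp
    · filter_upwards [ae_restrict_of_ae h] with ω hω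
      simp [hω]
  have h3 : 0 < c * b₀ ^ (2 - α) := by positivity
  linarith

/-- The persistence exponent of the integrated walk. -/
lemma IsIID.sameOrder_persistenceProb (hX : IsIID P X) (hm : ∀ i, Measurable (X i))
    (hi : Integrable (X 0) P) (h0 : ∫ ω, X 0 ω ∂P = 0) {α : ℝ} (hα : 1 < α)
    (hs : TailScaling P (X 0) α) (hd : DecayAssumption P (X 0)) :
    SameOrder (fun n => persistenceProb P X n) (fun n => (n : ℝ) ^ (-((1 - 1 / α) / 2))) := by
  have hne := hs.not_ae_zero
  have hα0 : 0 < α := by linarith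
  have hα1 : 1 / α < 1 := by rw [div_lt_one hα0]; exact hα
  have hα2 : 0 < 1 / α := by positivity
  set γ : ℝ := (1 - 1 / α) / 2 with hγ
  obtain ⟨D, hD, hmax⟩ := hX.exists_maximal_bound_rpow hm hi h0 hα hs
  obtain ⟨d, _, hd0, _, habs⟩ := hX.sameOrder_integral_abs hm hi h0 hα hs
  obtain ⟨G, hG0, hG⟩ := hX.exists_integral_slopeGap_le hm hi (measure_neg_pos hi h0 hne)
    (measure_neg_lt_one (hm 0) hi h0 hne) hd
  have hE := integral_negPart_pos hi h0 hne
  set E : ℝ := ∫ ω, max (-X 0 ω) 0 ∂P with hEdef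
  set p : ℕ → ℝ := persistenceProb P X with hp
  have hp0 : ∀ n, 0 ≤ p n := persistenceProb_nonneg
  set C : ℝ := Real.sqrt (2 * D * 3 ^ (1 / α) / E) with hC
  have hup : ∀ n : ℕ, 1 ≤ n → p n ≤ C * (n : ℝ) ^ (-γ) := by
    intro n hn
    have hn0 : (0 : ℝ) < n := by exact_mod_cast hn
    obtain ⟨M, hMi, hM, hMb⟩ := hmax (n + 2) (by omega)
    have h1 := hX.conv_persistenceProb_le hm hi hMi hM
    -- By monotonicity each of the `n + 1` products is at least `p n ^ 2`; one of them is dropped.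
    have h2 : n * p n ^ 2 ≤ ∑ i ∈ Finset.range (n + 1), p i * p (n - i) := by
      have h3 : ∀ i ∈ Finset.range (n + 1), p n ^ 2 ≤ p i * p (n - i) := by
        intro i hi
        rw [sq]
        exact mul_le_mul (persistenceProb_antitone (Nat.lt_succ_iff.1 (Finset.mem_range.1 hi)))
          (persistenceProb_antitone (Nat.sub_le _ _)) (hp0 _) (hp0 _)
      have h4 := Finset.sum_le_sum h3
      rw [Finset.sum_const, Finset.card_range, nsmul_eq_mul] at h4
      refine le_trans ?_ h4
      gcongr
      exact_mod_cast Nat.le_succ n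
    have h5 : ((n + 2 : ℕ) : ℝ) ^ (1 / α) ≤ 3 ^ (1 / α) * (n : ℝ) ^ (1 / α) := by
      rw [← Real.mul_rpow (by norm_num) hn0.le]
      refine Real.rpow_le_rpow (by positivity) ?_ hα2.le
      have : (1 : ℝ) ≤ n := by exact_mod_cast hn
      push_cast; linarith
    have h6 : E * (n * p n ^ 2) ≤ 2 * (D * (3 ^ (1 / α) * (n : ℝ) ^ (1 / α))) := by
      calc _ ≤ E * ∑ i ∈ Finset.range (n + 1), p i * p (n - i) := by gcongr
        _ ≤ 2 * ∫ ω, M ω ∂P := h1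
        _ ≤ 2 * (D * ((n + 2 : ℕ) : ℝ) ^ (1 / α)) := by gcongr
        _ ≤ _ := by gcongr
    have h7 : (n : ℝ) ^ (1 / α) = n * ((n : ℝ) ^ (-γ)) ^ 2 := by
      rw [← Real.rpow_natCast, ← Real.rpow_mul hn0.le]
      nth_rw 2 [← Real.rpow_one (n : ℝ)]
      rw [← Real.rpow_add hn0]
      congr 1; rw [hγ]; push_cast; ring
    refine le_of_sq_le_sq ?_ (by positivity)
    rw [mul_pow, hC, Real.sq_sqrt (by positivity), div_mul_eq_mul_div, le_div_iff₀ hE]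
    rw [h7] at h6
    refine le_of_mul_le_mul_left ?_ hn0
    linarith
  -- In `d / (2 * G)`, `d` bounds the first absolute moment from below, `2` is the cost of passing
  -- to the negative part, and `G` compares slope gaps with products.
  obtain ⟨c', hc', hlow⟩ := exists_le_of_convolution (p := p) (γ := γ) (C := C)
    (c := d / (2 * G)) (by rw [hγ]; linarith) (by rw [hγ]; linarith) persistenceProb_antitone hp0
    (persistenceProb_le_one 0) hup (by positivity) (by
      intro n hn
      have h1 := hX.integral_abs_le_sum_slopeGap hm hi h0 n
      have h2 := h1.trans (Finset.sum_le_sum fun i _ => hG n i)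
      rw [← Finset.mul_sum] at h2
      have h3 := (habs (n + 1) (by omega)).1
      have h4 : (n : ℝ) ^ (1 - 2 * γ) ≤ ((n + 1 : ℕ) : ℝ) ^ (1 / α) := by
        rw [show 1 - 2 * γ = 1 / α by rw [hγ]; ring]
        refine Real.rpow_le_rpow (by positivity) ?_ hα2.le
        push_cast; linarith
      have h5 : d * (n : ℝ) ^ (1 - 2 * γ) ≤ d * ((n + 1 : ℕ) : ℝ) ^ (1 / α) := by gcongr
      rw [div_mul_eq_mul_div, div_le_iff₀ (by positivity)]
      linarith)
  refine ⟨c', C + 1, hc', by positivity, fun n hn => ⟨hlow n hn, (hup n hn).trans ?_⟩⟩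
  gcongr
  linarith

end

section

variable {Ω : Type*} [MeasurableSpace Ω] {P : Measure Ω} [IsProbabilityMeasure P]
  {X : ℕ → Ω → ℝ}

/-! ### Measurable versions -/

/-- `IsIID` provides only almost everywhere measurability. All quantities in the theorem are
unchanged under almost sure modification, so measurable versions suffice. -/
lemma IsIID.exists_measurable (hX : IsIID P X) :
    ∃ X' : ℕ → Ω → ℝ, (∀ i, Measurable (X' i)) ∧ (∀ i, X i =ᵐ[P] X' i) ∧ IsIID P X' := by
  have hm : ∀ i, AEMeasurable (X i) P := fun i => (hX.ident i).aemeasurable_fst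
  have he : ∀ i, X i =ᵐ[P] (hm i).mk (X i) := fun i => (hm i).ae_eq_mk
  have hid : ∀ i, IdentDistrib ((hm i).mk (X i)) (X i) P P := fun i =>
    (IdentDistrib.of_ae_eq (hm i) (he i)).symm
  exact ⟨fun i => (hm i).mk (X i), fun i => (hm i).measurable_mk, he,
    (iIndepFun_congr he).1 hX.indep, fun i => ((hid i).trans (hX.ident i)).trans (hid 0).symm⟩

lemma partialSum_ae_eq {X' : ℕ → Ω → ℝ} (h : ∀ i, X i =ᵐ[P] X' i) :
    ∀ᵐ ω ∂P, ∀ n, partialSum X n ω = partialSum X' n ω := by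
  filter_upwards [ae_all_iff.2 h] with ω hω n
  exact Finset.sum_congr rfl fun i _ => hω i

lemma persistenceProb_congr {X' : ℕ → Ω → ℝ} (h : ∀ i, X i =ᵐ[P] X' i) :
    persistenceProb P X = persistenceProb P X' := by
  ext n
  refine measureReal_congr ?_
  filter_upwards [partialSum_ae_eq h] with ω hω
  have e : ∀ k, iteratedSum X k ω = iteratedSum X' k ω := fun k =>
    Finset.sum_congr rfl fun i _ => hω i
  change (∀ k ∈ Finset.Icc 1 n, iteratedSum X k ω < 0) =
    ∀ k ∈ Finset.Icc 1 n, iteratedSum X' k ω < 0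
  simp_rw [e]

lemma integral_abs_partialSum_congr {X' : ℕ → Ω → ℝ} (h : ∀ i, X i =ᵐ[P] X' i) (n : ℕ) :
    ∫ ω, |partialSum X n ω| ∂P = ∫ ω, |partialSum X' n ω| ∂P := by
  refine integral_congr_ae ?_
  filter_upwards [partialSum_ae_eq h] with ω hω
  simp only [hω]

lemma DecayAssumption.congr {Z Z' : Ω → ℝ} (hd : DecayAssumption P Z) (h : Z =ᵐ[P] Z') :
    DecayAssumption P Z' := by
  have e : ∀ t : ℝ, P.real {ω | -Z ω > t} = P.real {ω | -Z' ω > t} := by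
    intro t
    refine measureReal_congr ?_
    filter_upwards [h] with ω hω
    change (-Z ω > t) = (-Z' ω > t)
    rw [hω]
  obtain ⟨r, θ, K, L, hr, hθ, h⟩ := hd
  refine ⟨r, θ, K, L, hr, hθ, fun t s ht hs => ?_⟩
  simp_rw [← e]
  exact h t s ht hs

/-! ### Square integrable variables -/

/-- For exponent `2` the truncated second moment need only lie between positive constants, and on `b
< |Z|` one has `|Z| ≤ Z ^ 2 / b`. -/
lemma tailScaling_two {Z : Ω → ℝ} (hm : Measurable Z) (h2 : MemLp Z 2 P) (hne : ¬ Z =ᵐ[P] 0) :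
    TailScaling P Z 2 := by
  have hsq := h2.integrable_sq
  have hi : Integrable Z P := h2.integrable (by norm_num)
  set V : ℝ := ∫ ω, Z ω ^ 2 ∂P with hV
  have hV0 : 0 ≤ V := integral_nonneg fun ω => sq_nonneg _
  obtain ⟨N, hN⟩ : ∃ N : ℕ, 0 < ∫ ω in {ω | |Z ω| ≤ N}, Z ω ^ 2 ∂P := by
    by_contra! h
    refine hne ?_
    have h1 : ∀ N : ℕ, ∀ᵐ ω ∂P, |Z ω| ≤ N → Z ω ^ 2 = 0 := by
      intro N
      have h2 : ∫ ω in {ω | |Z ω| ≤ N}, Z ω ^ 2 ∂P = 0 :=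
        le_antisymm (h N) (integral_nonneg fun ω => sq_nonneg _)
      have h3 := (integral_eq_zero_iff_of_nonneg (fun ω => sq_nonneg (Z ω))
        hsq.integrableOn).1 h2
      exact (ae_restrict_iff' (measurableSet_abs_le hm N)).1 h3
    filter_upwards [ae_all_iff.2 h1] with ω hω
    obtain ⟨N, hN⟩ := exists_nat_ge |Z ω|
    exact pow_eq_zero_iff (two_ne_zero) |>.1 (hω N hN)
  refine ⟨N + 1, ∫ ω in {ω | |Z ω| ≤ N}, Z ω ^ 2 ∂P, V + 1, by positivity, hN, by positivity,
    fun b hb => ?_⟩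
  have hb0 : 0 < b := lt_of_lt_of_le (by positivity) hb
  rw [sub_self, Real.rpow_zero, mul_one, mul_one, show (1 : ℝ) - 2 = -1 by norm_num,
    Real.rpow_neg_one]
  refine ⟨?_, ?_, ?_⟩
  · refine setIntegral_mono_set hsq.integrableOn
      (Filter.Eventually.of_forall fun ω => sq_nonneg _) (LE.le.eventuallyLE ?_)
    intro ω (hω : |Z ω| ≤ N)
    change |Z ω| ≤ b
    linarith
  · refine (setIntegral_le_integral hsq (Filter.Eventually.of_forall fun ω => sq_nonneg _)).trans ?_
    linarith
  · have h1 : ∫ ω in {ω | b < |Z ω|}, |Z ω| ∂P ≤ ∫ ω in {ω | b < |Z ω|}, Z ω ^ 2 * b⁻¹ ∂P := by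
      refine setIntegral_mono_on hi.abs.integrableOn (hsq.mul_const _).integrableOn
        (measurableSet_lt_abs hm b) fun ω (hω : b < |Z ω|) => ?_
      rw [← div_eq_mul_inv, le_div_iff₀ hb0, ← sq_abs, sq]
      gcongr
    refine h1.trans ((setIntegral_le_integral (hsq.mul_const _)
      (Filter.Eventually.of_forall fun ω => by positivity)).trans ?_)
    rw [integral_mul_const]
    gcongr
    linarith

/-! ### Polynomial tails -/

/-- Layer cake for the truncated variable: levels above `b` contribute nothing, and `2 * C * t ^ (1
- α)` is integrable at `0` because `α < 2`. -/
lemma setIntegral_sq_le_of_tail {f : Ω → ℝ} (hm : Measurable f) (hf : ∀ ω, 0 ≤ f ω) {α C : ℝ}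
    (hC : 0 ≤ C) (hα : α < 2) (h : ∀ t : ℝ, 0 < t → P.real {ω | t < f ω} ≤ C * t ^ (-α)) {b : ℝ}
    (hb : 0 < b) :
    ∫ ω in {ω | f ω ≤ b}, f ω ^ 2 ∂P ≤ 2 * C / (2 - α) * b ^ (2 - α) := by
  have hS : MeasurableSet {ω | f ω ≤ b} := measurableSet_le hm measurable_const
  set g : Ω → ℝ := {ω | f ω ≤ b}.indicator f with hg
  have hgm : Measurable g := hm.indicator hS
  have hg0 : ∀ ω, 0 ≤ g ω := fun ω => Set.indicator_nonneg (fun _ _ => hf _) _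
  have e : ∫ ω in {ω | f ω ≤ b}, f ω ^ 2 ∂P = ∫ ω, g ω ^ (2 : ℝ) ∂P := by
    rw [← integral_indicator hS]
    congr 1
    ext ω
    by_cases hω : f ω ≤ b <;> simp [hg, hω]
  have hI : IntervalIntegrable (fun t : ℝ => 2 * C * t ^ (1 - α)) volume 0 b :=
    (intervalIntegral.intervalIntegrable_rpow' (by linarith)).const_mul _
  have hlay := lintegral_rpow_eq_lintegral_meas_lt_mul P (Filter.Eventually.of_forall hg0)
    hgm.aemeasurable (p := 2) (by norm_num)
  rw [e, integral_eq_lintegral_of_nonneg_ae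
    (Filter.Eventually.of_forall fun ω => Real.rpow_nonneg (hg0 ω) _)
    (hgm.pow_const _).aestronglyMeasurable]
  refine ENNReal.toReal_le_of_le_ofReal (mul_nonneg (div_nonneg (by linarith) (by linarith))
    (by positivity)) ?_
  rw [hlay, ← lintegral_const_mul' _ _ ENNReal.ofReal_ne_top]
  have hval : ∫ t in Set.Ioc 0 b, 2 * C * t ^ (1 - α) = 2 * C / (2 - α) * b ^ (2 - α) := by
    rw [← intervalIntegral.integral_of_le hb.le, intervalIntegral.integral_const_mul,
      integral_rpow (Or.inl (by linarith)), show 1 - α + 1 = 2 - α by ring,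
      Real.zero_rpow (by linarith)]
    ring
  rw [← hval, ofReal_integral_eq_lintegral_ofReal
    ((intervalIntegrable_iff_integrableOn_Ioc_of_le hb.le).1 hI)
    ((ae_restrict_mem measurableSet_Ioc).mono fun t ht => by
      have := ht.1
      positivity), ← Set.Ioc_union_Ioi_eq_Ioi hb.le]
  refine (lintegral_union_le _ _ _).trans ?_
  have hz : ∫⁻ t in Set.Ioi b, ENNReal.ofReal 2 * (P {ω | t < g ω} *
      ENNReal.ofReal (t ^ ((2 : ℝ) - 1))) = 0 := by
    rw [setLIntegral_congr_fun (g := fun _ => 0) measurableSet_Ioi, lintegral_zero]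
    intro t (ht : b < t)
    have : {ω | t < g ω} = ∅ := by
      refine Set.eq_empty_of_forall_notMem fun ω (hω : t < g ω) => ?_
      by_cases h1 : ω ∈ {ω | f ω ≤ b}
      · have h2 : f ω ≤ b := h1
        rw [hg, Set.indicator_of_mem h1] at hω; linarith
      · rw [hg, Set.indicator_of_notMem h1] at hω; linarith
    simp [this]
  rw [hz, add_zero]
  refine setLIntegral_mono' measurableSet_Ioc fun t ht => ?_
  have ht0 := ht.1
  rw [← ofReal_measureReal, ← ENNReal.ofReal_mul (by positivity),
    ← ENNReal.ofReal_mul (by positivity)]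
  refine ENNReal.ofReal_le_ofReal ?_
  have h1 : P.real {ω | t < g ω} ≤ C * t ^ (-α) :=
    (measureReal_mono fun ω (hω : t < g ω) => hω.trans_le
      (Set.indicator_le_self' (fun ω _ => hf ω) ω)).trans (h t ht0)
  have e2 : t ^ (1 - α) = t ^ (-α) * t ^ ((2 : ℝ) - 1) := by
    rw [← Real.rpow_add ht0]; congr 1; ring
  rw [e2]
  have : 0 ≤ t ^ ((2 : ℝ) - 1) := by positivity
  nlinarith

/-- Layer cake again: levels up to `b` only see the event `b < f`, which gives the summand `C`;
higher levels give `C / (α - 1)`. -/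
lemma lintegral_indicator_le_of_tail {f : Ω → ℝ} (hm : Measurable f) (hf : ∀ ω, 0 ≤ f ω)
    {α C : ℝ} (hC : 0 ≤ C) (hα : 1 < α)
    (h : ∀ t : ℝ, 0 < t → P.real {ω | t < f ω} ≤ C * t ^ (-α)) {b : ℝ} (hb : 0 < b) :
    ∫⁻ ω, ENNReal.ofReal ({ω | b < f ω}.indicator f ω) ∂P ≤
      ENNReal.ofReal ((C + C / (α - 1)) * b ^ (1 - α)) := by
  have hS : MeasurableSet {ω | b < f ω} := measurableSet_lt measurable_const hm
  set g : Ω → ℝ := {ω | b < f ω}.indicator f with hg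
  have hgm : Measurable g := hm.indicator hS
  have hg0 : ∀ ω, 0 ≤ g ω := fun ω => Set.indicator_nonneg (fun _ _ => hf _) _
  have hgf : ∀ ω, g ω ≤ f ω := Set.indicator_le_self' fun ω _ => hf ω
  have hI := integrableOn_Ioi_rpow_of_lt (a := -α) (by linarith) hb
  have hval : ∫ t in Set.Ioi b, C * t ^ (-α) = C / (α - 1) * b ^ (1 - α) := by
    rw [integral_const_mul, integral_Ioi_rpow_of_lt (by linarith) hb,
      show -α + 1 = -(α - 1) by ring, show 1 - α = -(α - 1) by ring, neg_div_neg_eq]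
    ring
  have hα1 : 0 ≤ C / (α - 1) := div_nonneg hC (by linarith)
  rw [lintegral_eq_lintegral_meas_lt P (Filter.Eventually.of_forall hg0) hgm.aemeasurable,
    add_mul, ENNReal.ofReal_add (by positivity) (by positivity), ← hval,
    ofReal_integral_eq_lintegral_ofReal (hI.const_mul C)
    ((ae_restrict_mem measurableSet_Ioi).mono fun t (ht : b < t) => by
      have := hb.trans ht
      positivity), ← Set.Ioc_union_Ioi_eq_Ioi hb.le]
  refine (lintegral_union_le _ _ _).trans (add_le_add ?_ ?_)
  · have hle : ∀ t ∈ Set.Ioc 0 b, P {ω | t < g ω} ≤ ENNReal.ofReal (C * b ^ (-α)) := by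
      intro t ht
      rw [← ofReal_measureReal]
      refine ENNReal.ofReal_le_ofReal ((measureReal_mono fun ω (hω : t < g ω) => ?_).trans (h b hb))
      by_contra h1
      rw [hg, Set.indicator_of_notMem h1] at hω
      linarith [ht.1]
    refine (setLIntegral_mono' measurableSet_Ioc hle).trans_eq ?_
    rw [setLIntegral_const, Real.volume_Ioc, sub_zero, ← ENNReal.ofReal_mul (by positivity),
      mul_assoc, ← Real.rpow_add_one hb.ne']
    congr 3
    ring
  · refine setLIntegral_mono' measurableSet_Ioi fun t (ht : b < t) => ?_
    rw [← ofReal_measureReal]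
    exact ENNReal.ofReal_le_ofReal ((measureReal_mono fun ω (hω : t < g ω) =>
      hω.trans_le (hgf ω)).trans (h t (hb.trans ht)))

lemma setIntegral_le_of_tail {f : Ω → ℝ} (hm : Measurable f) (hf : ∀ ω, 0 ≤ f ω) {α C : ℝ}
    (hC : 0 ≤ C) (hα : 1 < α) (h : ∀ t : ℝ, 0 < t → P.real {ω | t < f ω} ≤ C * t ^ (-α)) {b : ℝ}
    (hb : 0 < b) : ∫ ω in {ω | b < f ω}, f ω ∂P ≤ (C + C / (α - 1)) * b ^ (1 - α) := by
  have hS : MeasurableSet {ω | b < f ω} := measurableSet_lt measurable_const hm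
  have hg0 : ∀ ω, 0 ≤ {ω | b < f ω}.indicator f ω := fun ω =>
    Set.indicator_nonneg (fun _ _ => hf _) _
  rw [← integral_indicator hS, integral_eq_lintegral_of_nonneg_ae
    (Filter.Eventually.of_forall hg0) (hm.indicator hS).aestronglyMeasurable]
  have : 0 ≤ C / (α - 1) := div_nonneg hC (by linarith)
  exact ENNReal.toReal_le_of_le_ofReal (by positivity)
    (lintegral_indicator_le_of_tail hm hf hC hα h hb)

lemma integrable_of_tail {f : Ω → ℝ} (hm : Measurable f) (hf : ∀ ω, 0 ≤ f ω) {α C : ℝ}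
    (hC : 0 ≤ C) (hα : 1 < α) (h : ∀ t : ℝ, 0 < t → P.real {ω | t < f ω} ≤ C * t ^ (-α)) :
    Integrable f P := by
  have hS : MeasurableSet {ω | 1 < f ω} := measurableSet_lt measurable_const hm
  have hg0 : ∀ ω, 0 ≤ {ω | 1 < f ω}.indicator f ω := fun ω =>
    Set.indicator_nonneg (fun _ _ => hf _) _
  have hi : Integrable ({ω | 1 < f ω}.indicator f) P := by
    refine (lintegral_ofReal_ne_top_iff_integrable (hm.indicator hS).aestronglyMeasurable
      (Filter.Eventually.of_forall hg0)).1 ?_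
    exact ne_top_of_le_ne_top ENNReal.ofReal_ne_top
      (lintegral_indicator_le_of_tail hm hf hC hα h one_pos)
  refine (hi.add (integrable_const 1)).mono' hm.aestronglyMeasurable
    (Filter.Eventually.of_forall fun ω => ?_)
  rw [Real.norm_eq_abs, abs_of_nonneg (hf ω), Pi.add_apply]
  by_cases h1 : ω ∈ {ω | 1 < f ω}
  · rw [Set.indicator_of_mem h1]; linarith
  · have h2 : f ω ≤ 1 := not_lt.1 h1
    rw [Set.indicator_of_notMem h1]; linarith

end

section

variable {Ω : Type*} [MeasurableSpace Ω] {P : Measure Ω} [IsProbabilityMeasure P]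

/-! ### Pareto variables -/

lemma HasParetoTail.congr {Y Y' : Ω → ℝ} {α : ℝ} (hY : HasParetoTail P Y α) (h : Y =ᵐ[P] Y') :
    HasParetoTail P Y' α := by
  intro y hy
  rw [← hY y hy]
  refine measureReal_congr ?_
  filter_upwards [h] with ω hω
  change (Y' ω > y) = (Y ω > y)
  rw [hω]

variable {Y : Ω → ℝ} {α : ℝ}

lemma HasParetoTail.ae_one_lt (hY : HasParetoTail P Y α) (hm : Measurable Y) :
    ∀ᵐ ω ∂P, 1 < Y ω := by
  have h := hY 1 le_rfl
  rw [Real.one_rpow] at h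
  have hS : MeasurableSet {ω | Y ω > 1} := measurableSet_lt measurable_const hm
  have h1 : P {ω | Y ω > 1} = 1 := by
    rw [← ofReal_measureReal (μ := P), h, ENNReal.ofReal_one]
  exact (prob_compl_eq_zero_iff hS).2 h1

lemma HasParetoTail.integrable (hY : HasParetoTail P Y α) (hm : Measurable Y) (hα : 1 < α) :
    Integrable Y P := by
  have habs : Integrable (fun ω => |Y ω|) P := by
    refine integrable_of_tail (C := 1) hm.norm (fun ω => abs_nonneg _) zero_le_one hα
      fun t ht => ?_
    rw [one_mul]
    rcases le_total 1 t with h | h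
    · rw [← hY t h]
      refine (measureReal_congr ?_).le
      filter_upwards [hY.ae_one_lt hm] with ω hω
      change (t < |Y ω|) = (Y ω > t)
      rw [abs_of_pos (by linarith)]
    · exact measureReal_le_one.trans (Real.one_le_rpow_of_pos_of_le_one_of_nonpos ht h (by linarith))
  exact (integrable_norm_iff hm.aestronglyMeasurable).1 habs

/-- Centred Pareto variables have regularly behaved tails. -/
lemma HasParetoTail.tailScaling (hY : HasParetoTail P Y α) (hm : Measurable Y) (hα : 1 < α)
    (hα2 : α < 2) : TailScaling P (fun ω => Y ω - ∫ ω', Y ω' ∂P) α := by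
  have hi := hY.integrable hm hα
  have hone := hY.ae_one_lt hm
  set m : ℝ := ∫ ω', Y ω' ∂P with hmdef
  have hm1 : 1 ≤ m := by
    have := integral_mono_ae (integrable_const 1) hi (hone.mono fun ω h => h.le)
    simpa using this
  have hα0 : 0 < α := by linarith
  set X : Ω → ℝ := fun ω => Y ω - m with hX
  have hXm : Measurable X := hm.sub_const m
  -- Above level `m` only the upper tail contributes, since `Y > 1` almost surely; below it the
  -- right side is at least `1`.
  have htail : ∀ t : ℝ, 0 < t → P.real {ω | t < |X ω|} ≤ m ^ α * t ^ (-α) := by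
    intro t ht
    rcases le_total m t with h | h
    · have h1 : P.real {ω | t < |X ω|} ≤ P.real {ω | Y ω > t} := by
        refine ENNReal.toReal_mono (measure_ne_top _ _) (measure_mono_ae ?_)
        filter_upwards [hone] with ω hω (hω2 : t < |Y ω - m|)
        change t < Y ω
        rcases lt_abs.1 hω2 with h2 | h2 <;> linarith
      rw [hY t (hm1.trans h)] at h1
      refine h1.trans (le_mul_of_one_le_left (by positivity) (Real.one_le_rpow hm1 hα0.le))
    · refine measureReal_le_one.trans ?_
      rw [Real.rpow_neg ht.le, ← div_eq_mul_inv, ← Real.div_rpow (by linarith) ht.le]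
      exact Real.one_le_rpow ((one_le_div ht).2 h) hα0.le
  have hmα : 0 ≤ m ^ α := by positivity
  have h2α : (1 : ℝ) < 2 ^ α := Real.one_lt_rpow (by norm_num) hα0
  set C : ℝ := 2 * m ^ α / (2 - α) + (m ^ α + m ^ α / (α - 1)) with hC
  have hC1 : 0 ≤ 2 * m ^ α / (2 - α) := div_nonneg (by linarith) (by linarith)
  have hC2 : 0 < m ^ α := by positivity
  have hC3 : 0 ≤ m ^ α / (α - 1) := div_nonneg hmα (by linarith)
  refine ⟨4 * m, (2 ^ α - 1) / 16, C, by linarith, by linarith, by linarith, fun b hb => ?_⟩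
  have hb0 : 0 < b := by linarith
  refine ⟨?_, ?_, ?_⟩
  · have hS : MeasurableSet {ω | |X ω| ≤ b} := measurableSet_abs_le hXm b
    have hU : MeasurableSet {ω | b / 4 < X ω} := measurableSet_lt measurable_const hXm
    -- As `b ≥ 4 * m`, the event contains `b / 2 < Y ≤ b + m`. On it `X ^ 2` exceeds `b ^ 2 / 16`,
    -- the source of the constant.
    have hprob : (2 ^ α - 1) * b ^ (-α) ≤ P.real ({ω | |X ω| ≤ b} ∩ {ω | b / 4 < X ω}) := by
      have h1 := hY (b / 2) (by linarith)
      have h2 := hY (b + m) (by linarith)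
      have h3 : P.real {ω | Y ω > b / 2} ≤
          P.real ({ω | |X ω| ≤ b} ∩ {ω | b / 4 < X ω}) + P.real {ω | Y ω > b + m} := by
        refine (measureReal_mono fun ω (hω : Y ω > b / 2) => ?_).trans (measureReal_union_le _ _)
        rcases le_or_gt (Y ω) (b + m) with h4 | h4
        · refine Or.inl ⟨?_, ?_⟩
          · change |Y ω - m| ≤ b
            rw [abs_le]
            constructor <;> linarith
          · change b / 4 < Y ω - m
            linarith
        · exact Or.inr h4
      have h4 : (b + m) ^ (-α) ≤ b ^ (-α) :=
        Real.rpow_le_rpow_of_nonpos hb0 (by linarith) (by linarith)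
      have h5 : (b / 2) ^ (-α) = 2 ^ α * b ^ (-α) := by
        rw [Real.div_rpow hb0.le (by norm_num), Real.rpow_neg (by norm_num : (0 : ℝ) ≤ 2)]
        field_simp
      rw [h1, h2, h5] at h3
      linarith
    have hint : IntegrableOn (fun ω => X ω ^ 2) {ω | |X ω| ≤ b} P := by
      refine Measure.integrableOn_of_bounded (M := b ^ 2) (measure_ne_top _ _)
        (hXm.pow_const 2).aestronglyMeasurable ?_
      filter_upwards [ae_restrict_mem hS] with ω (hω : |X ω| ≤ b)
      rw [Real.norm_eq_abs, abs_pow]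
      gcongr
    calc (2 ^ α - 1) / 16 * b ^ (2 - α) = (b / 4) ^ 2 * ((2 ^ α - 1) * b ^ (-α)) := by
          rw [sub_eq_add_neg (2 : ℝ) α, Real.rpow_add hb0, Real.rpow_ofNat]; ring
      _ ≤ (b / 4) ^ 2 * P.real ({ω | |X ω| ≤ b} ∩ {ω | b / 4 < X ω}) := by gcongr
      _ = ∫ ω in {ω | |X ω| ≤ b} ∩ {ω | b / 4 < X ω}, (b / 4) ^ 2 ∂P := by
          rw [setIntegral_const, smul_eq_mul, mul_comm]
      _ ≤ ∫ ω in {ω | |X ω| ≤ b} ∩ {ω | b / 4 < X ω}, X ω ^ 2 ∂P := by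
          refine setIntegral_mono_on (integrable_const _) (hint.mono_set Set.inter_subset_left)
            (hS.inter hU) fun ω hω => ?_
          have : b / 4 < X ω := hω.2
          gcongr
      _ ≤ _ := setIntegral_mono_set hint (Filter.Eventually.of_forall fun ω => sq_nonneg _)
          (LE.le.eventuallyLE Set.inter_subset_left)
  · have h := setIntegral_sq_le_of_tail (P := P) (f := fun ω => |X ω|) hXm.norm
      (fun ω => abs_nonneg _) hmα hα2 htail hb0
    simp only [sq_abs] at h
    refine h.trans ?_
    gcongr
    linarith
  · refine (setIntegral_le_of_tail (P := P) (f := fun ω => |X ω|) hXm.norm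
      (fun ω => abs_nonneg _) hmα hα htail hb0).trans ?_
    gcongr
    linarith

/-- The properties of walks with centred Pareto steps. -/
theorem centred_pareto {Y : ℕ → Ω → ℝ} (hα : 1 < α) (hα2 : α < 2) (hiid : IsIID P Y)
    (hY : HasParetoTail P (Y 0) α) :
    Integrable (Y 0) P ∧
    Integrable (centred P Y 0) P ∧
    ∫ ω, centred P Y 0 ω ∂P = 0 ∧
    (∃ b : ℝ, ∀ᵐ ω ∂P, b ≤ centred P Y 0 ω) ∧
    DecayAssumption P (centred P Y 0) ∧
    SameOrder (fun n => ∫ ω, |partialSum (centred P Y) n ω| ∂P)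
      (fun n => (n : ℝ) ^ (1 / α)) ∧
    SameOrder (fun n => persistenceProb P (centred P Y) n)
      (fun n => (n : ℝ) ^ (-((1 - 1 / α) / 2))) := by
  obtain ⟨Y', hm', he, hiid'⟩ := hiid.exists_measurable
  have hY' := hY.congr (he 0)
  have hi' := hY'.integrable (hm' 0) hα
  have hi : Integrable (Y 0) P := (integrable_congr (he 0)).2 hi'
  have hmean : ∫ ω, Y 0 ω ∂P = ∫ ω, Y' 0 ω ∂P := integral_congr_ae (he 0)
  have hce : ∀ i, centred P Y' i =ᵐ[P] centred P Y i := by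
    intro i
    filter_upwards [he i] with ω hω
    simp only [centred, hω, hmean]
  have hsubm : Measurable fun x : ℝ => x - ∫ ω', Y' 0 ω' ∂P := measurable_id.sub_const _
  have hXiid : IsIID P (centred P Y') := hiid'.comp hsubm
  have hXm : ∀ i, Measurable (centred P Y' i) := fun i => hsubm.comp (hm' i)
  have hXi : Integrable (centred P Y' 0) P := hi'.sub (integrable_const _)
  have hX0 : ∫ ω, centred P Y' 0 ω ∂P = 0 := by
    simp only [centred]
    rw [integral_sub hi' (integrable_const _)]
    simp
  have hs : TailScaling P (centred P Y' 0) α := hY'.tailScaling (hm' 0) hα hα2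
  set m : ℝ := ∫ ω, Y' 0 ω ∂P with hm
  have hd : DecayAssumption P (centred P Y' 0) := by
    -- `-X > m` would force `Y < 0`, while `Y > 1` almost surely.
    refine decayAssumption_of_bddBelow (r := m) ?_ (measure_neg_pos hXi hX0 hs.not_ae_zero)
    rw [measureReal_eq_zero_iff, measure_eq_zero_iff_ae_notMem]
    filter_upwards [hY'.ae_one_lt (hm' 0)] with ω hω (h : -(Y' 0 ω - m) > m)
    linarith
  refine ⟨hi, (integrable_congr (hce 0)).1 hXi, (integral_congr_ae (hce 0)).symm.trans hX0,
    ⟨1 - m, ?_⟩, hd.congr (hce 0), ?_, ?_⟩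
  · filter_upwards [hY'.ae_one_lt (hm' 0), hce 0] with ω hω h
    rw [← h]
    change 1 - m ≤ Y' 0 ω - m
    linarith
  · simp_rw [← integral_abs_partialSum_congr hce]
    exact hXiid.sameOrder_integral_abs hXm hXi hX0 hα hs
  · rw [← persistenceProb_congr hce]
    exact hXiid.sameOrder_persistenceProb hXm hXi hX0 hα hs hd

lemma hasParetoTail_paretoMeasure {α : ℝ} (hα : 0 < α) :
    HasParetoTail (paretoMeasure 1 α) id α := by
  intro y hy
  have hy0 : 0 < y := by linarith
  change (paretoMeasure 1 α).real (Set.Ioi y) = _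
  have hI := integrableOn_Ioi_rpow_of_lt (a := -(α + 1)) (by linarith) hy0
  rw [measureReal_def, paretoMeasure, withDensity_apply _ measurableSet_Ioi,
    setLIntegral_congr_fun (g := fun x => ENNReal.ofReal (α * x ^ (-(α + 1)))) measurableSet_Ioi,
    ← ofReal_integral_eq_lintegral_ofReal (hI.const_mul α), integral_const_mul,
    integral_Ioi_rpow_of_lt (by linarith) hy0, show -(α + 1) + 1 = -α by ring, neg_div_neg_eq,
    mul_div_cancel₀ _ hα.ne', ENNReal.toReal_ofReal (by positivity)]
  · exact (ae_restrict_mem measurableSet_Ioi).mono fun t (ht : y < t) => by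
      have := hy0.trans ht
      positivity
  · intro x (hx : y < x)
    simp only [paretoPDF_of_le (hy.trans hx.le), Real.one_rpow, mul_one]

/-- The coordinates of an infinite product of copies of a probability measure are i.i.d. -/
lemma isIID_infinitePi (μ : Measure ℝ) [IsProbabilityMeasure μ] :
    IsIID (Measure.infinitePi fun _ : ℕ => μ) fun i ω => ω i :=
  ⟨iIndepFun_infinitePi (P := fun _ : ℕ => μ) (X := fun _ => id) fun _ => measurable_id, fun i =>
    ⟨(measurable_pi_apply i).aemeasurable, (measurable_pi_apply 0).aemeasurable, by
      rw [Measure.infinitePi_map_eval (fun _ : ℕ => μ) i,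
        Measure.infinitePi_map_eval (fun _ : ℕ => μ) 0]⟩⟩

/-- Walks with square integrable steps. -/
theorem sameOrder_of_memLp_two {X : ℕ → Ω → ℝ} (hX : IsIID P X) (h2 : MemLp (X 0) 2 P)
    (h0 : ∫ ω, X 0 ω ∂P = 0) (hne : ¬ X 0 =ᵐ[P] 0) :
    SameOrder (fun n => ∫ ω, |partialSum X n ω| ∂P) (fun n => Real.sqrt n) ∧
      (DecayAssumption P (X 0) →
        SameOrder (fun n => persistenceProb P X n) (fun n => (n : ℝ) ^ (-(1 / 4) : ℝ))) := by
  obtain ⟨X', hm', he, hX'⟩ := hX.exists_measurable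
  have h2' : MemLp (X' 0) 2 P := (memLp_congr_ae (he 0)).1 h2
  have h0' : ∫ ω, X' 0 ω ∂P = 0 := (integral_congr_ae (he 0)).symm.trans h0
  have hne' : ¬ X' 0 =ᵐ[P] 0 := fun h => hne ((he 0).trans h)
  have hi' : Integrable (X' 0) P := h2'.integrable (by norm_num)
  have hs := tailScaling_two (hm' 0) h2' hne'
  refine ⟨?_, fun hd => ?_⟩
  · simp_rw [integral_abs_partialSum_congr he, Real.sqrt_eq_rpow]
    exact hX'.sameOrder_integral_abs hm' hi' h0' one_lt_two hs
  · rw [persistenceProb_congr he]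
    have := hX'.sameOrder_persistenceProb hm' hi' h0' one_lt_two hs (hd.congr (he 0))
    rwa [show ((1 : ℝ) - 1 / 2) / 2 = 1 / 4 by norm_num] at this

end
theorem mainTheorem3 :
    -- finite second moment
    (∀ (Ω : Type*) [MeasurableSpace Ω] (P : Measure Ω) [IsProbabilityMeasure P]
        (X : ℕ → Ω → ℝ),
        IsIID P X → MemLp (X 0) 2 P → ∫ ω, X 0 ω ∂P = 0 → ¬ (X 0 =ᵐ[P] 0) →
        SameOrder (fun n => ∫ ω, |partialSum X n ω| ∂P) (fun n => Real.sqrt n) ∧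
        (DecayAssumption P (X 0) →
          SameOrder (fun n => persistenceProb P X n) (fun n => (n : ℝ) ^ (-(1 / 4) : ℝ)))) ∧
    -- centred Pareto variables
    (∀ α : ℝ, 1 < α → α < 2 →
      ∀ (Ω : Type*) [MeasurableSpace Ω] (P : Measure Ω) [IsProbabilityMeasure P]
        (Y : ℕ → Ω → ℝ),
        IsIID P Y → HasParetoTail P (Y 0) α →
        Integrable (Y 0) P ∧
        Integrable (centred P Y 0) P ∧
        ∫ ω, centred P Y 0 ω ∂P = 0 ∧
        (∃ b : ℝ, ∀ᵐ ω ∂P, b ≤ centred P Y 0 ω) ∧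
        DecayAssumption P (centred P Y 0) ∧
        SameOrder (fun n => ∫ ω, |partialSum (centred P Y) n ω| ∂P)
          (fun n => (n : ℝ) ^ (1 / α)) ∧
        SameOrder (fun n => persistenceProb P (centred P Y) n)
          (fun n => (n : ℝ) ^ (-((1 - 1 / α) / 2)))) ∧
    -- every exponent in `(0, 1/4)` is attained, by such variables
    (∀ γ : ℝ, 0 < γ → γ < 1 / 4 →
      ∃ α : ℝ, 1 < α ∧ α < 2 ∧ γ = (1 - 1 / α) / 2 ∧
      ∃ (Ω : Type) (_ : MeasurableSpace Ω) (P : Measure Ω) (_ : IsProbabilityMeasure P)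
        (Y : ℕ → Ω → ℝ),
        IsIID P Y ∧ HasParetoTail P (Y 0) α ∧
        IsIID P (centred P Y) ∧
        Integrable (centred P Y 0) P ∧
        ∫ ω, centred P Y 0 ω ∂P = 0 ∧
        SameOrder (fun n => persistenceProb P (centred P Y) n)
          (fun n => (n : ℝ) ^ (-γ))) := by
  refine ⟨fun Ω _ P _ X hX h2 h0 hne => sameOrder_of_memLp_two hX h2 h0 hne,
    fun α h1 h2 Ω _ P _ Y hiid hY => centred_pareto h1 h2 hiid hY, fun γ hγ0 hγ => ?_⟩
  have h1 : 0 < 1 - 2 * γ := by linarith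
  -- Solving for `α` gives `1 / (1 - 2 * γ)`, which maps `(0, 1/4)` onto `(1, 2)`. The sequence is
  -- realized by the coordinates of an infinite product of Pareto laws.
  have hγα : γ = (1 - 1 / (1 / (1 - 2 * γ))) / 2 := by rw [one_div_one_div]; ring
  have hα1 : 1 < 1 / (1 - 2 * γ) := by rw [lt_div_iff₀ h1]; linarith
  have hα2 : 1 / (1 - 2 * γ) < 2 := by rw [div_lt_iff₀ h1]; linarith
  set α : ℝ := 1 / (1 - 2 * γ)
  have hα0 : 0 < α := by linarith
  have := isProbabilityMeasure_paretoMeasure one_pos hα0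
  set Q : Measure (ℕ → ℝ) := Measure.infinitePi fun _ : ℕ => paretoMeasure 1 α with hQ
  have hiid : IsIID Q fun i ω => ω i := isIID_infinitePi _
  have hY : HasParetoTail Q (fun ω => ω 0) α := by
    intro y hy
    have e := Measure.map_apply (μ := Q) (measurable_pi_apply 0) (measurableSet_Ioi (a := y))
    rw [hQ, Measure.infinitePi_map_eval (fun _ : ℕ => paretoMeasure 1 α) 0] at e
    exact (congrArg ENNReal.toReal e.symm).trans (hasParetoTail_paretoMeasure hα0 y hy)
  obtain ⟨-, hi, h0, -, -, -, hp⟩ := centred_pareto hα1 hα2 hiid hY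
  rw [← hγα] at hp
  exact ⟨α, hα1, hα2, hγα, ℕ → ℝ, inferInstance, Q, inferInstance, fun i ω => ω i, hiid, hY,
    hiid.comp (measurable_id.sub_const _), hi, h0, hp⟩
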